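/- Let $Q$ be a probability distribution on $\mathbb{R}$ with $$\int x\,Q(dx)=0,\qquad \int x^2\,Q(dx)=1,\qquad b:=\int x^4\,Q(dx)<\infty .$$ Let $X_{ii}/\sqrt2$ ($i\in\mathbb{N}$) and $X_{ij}$ ($i<j$, $i,j\in\mathbb{N}$) be jointly independent real random variables on a probability space, each with distribution $Q$; put $X_{ji}:=X_{ij}$ for $i<j$ and $X_N:=(X_{ij})_{1\le i,j\le N}$. For $\mu,\nu\in\mathbb{R}$ the random variable $\det(X_N-\mu I_N)\det(X_N-\nu I_N)$ is integrable; set $$f(N;\mu,\nu):=\mathbb{E}\bigl(\det(X_N-\mu I_N)\cdot\det(X_N-\nu I_N)\bigr).$$ Then for every $\xi\in(-2,2)$ and all $\mu,\nu\in\mathbb{R}$, $$\lim_{N\to\infty}\sqrt{\frac{2\pi}{N^3}}\cdot\frac1{N!}\cdot e^{-N\xi^2/2}\cdot f\left(N;\sqrt N\,\xi+\frac{\mu}{\sqrt N\,\varrho(\xi)},\ \sqrt N\,\xi+\frac{\nu}{\sqrt N\,\varrho(\xi)}\right) =\exp\left(\frac{b-3}{2}\right)\cdot e^{\xi(\mu+\nu)/(2\varrho(\xi))}\cdot(2\pi\varrho(\xi))^3\cdot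 T(\pi(\mu-\nu)),$$ where $\varrho(\xi):=\frac1{2\pi}\sqrt{4-\xi^2}$ is the density of the semicircle law, $T(x):=\frac12\left(\frac{\sin x}{x^3}-\frac{\cos x}{x^2}\right)$ for $x\ne0$, and $T(0):=\frac16$. -/

import Mathlib

open MeasureTheory ProbabilityTheory Filter
open scoped Topology Nat

noncomputable section

/-- The family of entries of a real symmetric Wigner matrix with entry distribution `Q`
(the indices run over `0, 1, 2, …`): the array is symmetric, the variables `X i i / √2` and
`X i j` for `i < j` have distribution `Q`, and the entries on and above the diagonal are
jointly independent. -/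
structure IsWignerArray {Ω : Type*} [MeasurableSpace Ω] (P : Measure Ω) (Q : Measure ℝ)
    (X : ℕ → ℕ → Ω → ℝ) : Prop where
  symm : ∀ i j, X i j = X j i
  law_diag : ∀ i, HasLaw (fun ω => X i i ω / √2) Q P
  law_offdiag : ∀ i j, i < j → HasLaw (X i j) Q P
  indep : iIndepFun (fun p : {p : ℕ × ℕ // p.1 ≤ p.2} => X p.1.1 p.1.2) P

/-- The `N × N` random matrix formed by the first `N` rows and columns of the array. -/
def wignerMatrix {Ω : Type*} (X : ℕ → ℕ → Ω → ℝ) (N : ℕ) (ω : Ω) :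
    Matrix (Fin N) (Fin N) ℝ :=
  Matrix.of fun i j => X i j ω

/-- The product `det (X_N - μ I_N) * det (X_N - ν I_N)`. -/
def charDetProd {Ω : Type*} (X : ℕ → ℕ → Ω → ℝ) (N : ℕ) (μ ν : ℝ) (ω : Ω) : ℝ :=
  (wignerMatrix X N ω - μ • (1 : Matrix (Fin N) (Fin N) ℝ)).det *
    (wignerMatrix X N ω - ν • (1 : Matrix (Fin N) (Fin N) ℝ)).det

/-- The second-order correlation function of the characteristic polynomial,
`f(N; μ, ν) = E (det (X_N - μ I_N) * det (X_N - ν I_N))`. -/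
def corrFun {Ω : Type*} [MeasurableSpace Ω] (P : Measure Ω) (X : ℕ → ℕ → Ω → ℝ)
    (N : ℕ) (μ ν : ℝ) : ℝ :=
  ∫ ω, charDetProd X N μ ν ω ∂P

/-- The density of the semicircle law on `(-2, 2)`. -/
def semicircleDensity (ξ : ℝ) : ℝ := 1 / (2 * Real.pi) * √(4 - ξ ^ 2)

/-- The function `T(x) = (sin x / x³ - cos x / x²) / 2`, with `T(0) = 1/6`. -/
def limitT (x : ℝ) : ℝ :=
  if x = 0 then 1 / 6 else 1 / 2 * (Real.sin x / x ^ 3 - Real.cos x / x ^ 2)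

end

/-! The correlation function has an exact finite-`N` formula, to which Laplace-type asymptotics
apply. Put `β = (b - 3) / 2`, let `He_k` be the Hermite polynomials and let `a_j` be the Taylor
coefficients of `exp (β z²) / (1 - z)²`. Then `E det (X_N - x) det (X_N - y) = N! ∑_{k ≤ N} a_{N-k}
He_k(x) He_k(y) / k!` (`hasMean_det_mul_det`).

The formula is proved by induction on `N`. Both determinants are expanded along the first row and
column, and the first row, which is independent of the remaining minor, is averaged out
(`hasMean_det_mul_det_succ`). Fourth moments split into three Gaussian pairings and a cumulant term
with factor `b - 3`. What is left involves only the characteristic polynomial `p` of the minor: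
traces of adjugates are `-p'`, the trace of a product of two adjugates is a Wronskian of `p` divided
by `x - y`, and diagonal adjugate entries are characteristic polynomials one size smaller. On
Hermite polynomials these operations close up by `He_{k+1} = X He_k - He_k'` and by
Christoffel–Darboux, and they reproduce the recurrence `weightedSum_succ`. Minors remove arbitrary
indices, so the induction runs over all injective selections `e` of rows.

By Mehler's formula the sum without `N!` is the `N`-th Taylor coefficient of `weightGen β z *
mehlerKernel x y z`. Cauchy's formula on the circle of radius `exp (-1 / N)`, with angle `t / N`,
magnifies the singularity at `z = 1`. The rescaled integrand converges pointwise and is dominated by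
a multiple of `1 / (1 + t²)` (`tendsto_integral_scaledIntegrand`).

The limit is the integral over `t` of `(1 - i t)^(-5/2) exp (a (1 - i t) - c / (1 - i t))`, up to
constants. Expanding in `c` and inverting the Laplace transform of each power gives a Bessel series
of index `3/2`. Being half-integral, it is elementary, namely `limitT` (`sqrt_pi_mul_integral`). -/

/-- The unordered pair `{i, j}`, sorted. -/
def sortedPair (i j : ℕ) : {p : ℕ × ℕ // p.1 ≤ p.2} := ⟨(min i j, max i j), min_le_max⟩

/-- The symmetric submatrix of the array with rows and columns selected by `e`. -/
def wignerSubmatrix {Ω : Type*} (X : ℕ → ℕ → Ω → ℝ) {n : ℕ} (e : Fin n → ℕ) (ω : Ω) :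
    Matrix (Fin n) (Fin n) ℝ :=
  Matrix.of fun i j => X (e i) (e j) ω

/-! ### Integrability and independence of the entries. -/

lemma memLp_two_mul_of_memLp_four {Ω : Type*} [MeasurableSpace Ω] {P : Measure Ω}
    {f g : Ω → ℝ} (hf : MemLp f 4 P) (hg : MemLp g 4 P) :
    MemLp (fun ω => f ω * g ω) 2 P := by
  have : ENNReal.HolderTriple 4 4 2 := ⟨by
    rw [← two_mul, show (4 : ENNReal) = 2 * 2 by norm_num,
      ENNReal.mul_inv (by norm_num) (by norm_num), ← mul_assoc,
      ENNReal.mul_inv_cancel (by norm_num) (by norm_num), one_mul]⟩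
  exact hg.mul hf

lemma memLp_two_prod_of_iIndepFun {Ω ι : Type*} [MeasurableSpace Ω] {P : Measure Ω}
    [IsProbabilityMeasure P] {Y : ι → Ω → ℝ} (hY : iIndepFun Y P) (hm : ∀ i, MemLp (Y i) 2 P)
    (s : Finset ι) : MemLp (fun ω => ∏ i ∈ s, Y i ω) 2 P := by
  classical
  have hsm (s : Finset ι) : AEStronglyMeasurable (fun ω => ∏ i ∈ s, Y i ω) P :=
    Finset.aestronglyMeasurable_fun_prod _ fun i _ => (hm i).1
  rw [memLp_two_iff_integrable_sq (hsm s)]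
  have hsq : iIndepFun (fun i ω => Y i ω ^ 2) P :=
    hY.comp (fun _ x => x ^ 2) fun _ => by fun_prop
  simp only [← Finset.prod_pow]
  induction s using Finset.induction_on with
  | empty => simp
  | insert i s hi ih =>
    have h := (hsq.indepFun_finsetProd_of_notMem₀ (fun i => ((hm i).1.aemeasurable.pow_const 2))
      hi).symm
    simp only [Finset.prod_insert hi]
    refine IndepFun.integrable_mul (X := fun ω => Y i ω ^ 2) (Y := fun ω => ∏ j ∈ s, Y j ω ^ 2)
      ?_ ((hm i).integrable_sq) ih
    convert h using 1
    ext ω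
    simp

namespace IsWignerArray

variable {Ω : Type*} [MeasurableSpace Ω] {P : Measure Ω} {Q : Measure ℝ} {X : ℕ → ℕ → Ω → ℝ}

lemma eq_sortedPair (hX : IsWignerArray P Q X) (i j : ℕ) :
    X i j = X (sortedPair i j).1.1 (sortedPair i j).1.2 := by
  rcases le_total i j with h | h
  · simp [sortedPair, h]
  · simp [sortedPair, h, hX.symm i j]

lemma memLp_four_entry (hX : IsWignerArray P Q X) (hfourth : Integrable (fun x : ℝ => x ^ 4) Q)
    (i j : ℕ) : MemLp (X i j) 4 P := by
  have hid : MemLp (fun x : ℝ => x) 4 Q := by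
    rw [← integrable_norm_rpow_iff (by fun_prop) (by norm_num) (by norm_num)]
    convert hfourth using 2 with x
    norm_num
    rw [← abs_pow, abs_of_nonneg (show (0 : ℝ) ≤ x ^ 4 by positivity)]
  have key {Y : Ω → ℝ} (hY : HasLaw Y Q P) : MemLp Y 4 P := by
    rw [← hY.map_eq] at hid
    exact (memLp_map_measure_iff (by fun_prop) hY.aemeasurable).1 hid
  wlog hij : i ≤ j generalizing i j
  · rw [hX.symm i j]
    exact this j i (le_of_not_ge hij)
  rcases hij.lt_or_eq with h | rfl
  · exact key (hX.law_offdiag i j h)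
  · convert (key (hX.law_diag i)).const_mul (√2) using 2
    field_simp

lemma aemeasurable_entry (hX : IsWignerArray P Q X) (hfourth : Integrable (fun x : ℝ => x ^ 4) Q)
    (i j : ℕ) : AEMeasurable (X i j) P :=
  (hX.memLp_four_entry hfourth i j).1.aemeasurable

lemma integral_entry (hX : IsWignerArray P Q X) (hmean : ∫ x, x ∂Q = 0) (i j : ℕ) :
    ∫ ω, X i j ω ∂P = 0 := by
  wlog hij : i ≤ j generalizing i j
  · rw [hX.symm i j]
    exact this j i (le_of_not_ge hij)
  rcases hij.lt_or_eq with h | rfl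
  · rw [(hX.law_offdiag i j h).integral_eq, hmean]
  · have h := (hX.law_diag i).integral_eq
    rw [hmean, integral_div] at h
    simpa using h

lemma integral_entry_pow (hX : IsWignerArray P Q X) {i j : ℕ} (hij : i ≠ j) (k : ℕ) :
    ∫ ω, X i j ω ^ k ∂P = ∫ x, x ^ k ∂Q := by
  wlog h : i < j generalizing i j
  · rw [hX.symm i j]
    exact this hij.symm (lt_of_le_of_ne (le_of_not_gt h) hij.symm)
  have := (hX.law_offdiag i j h).integral_comp (f := fun x : ℝ => x ^ k) (by fun_prop)
  simpa [Function.comp_def] using this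

lemma integral_diag_sq (hX : IsWignerArray P Q X) (hvar : ∫ x, x ^ 2 ∂Q = 1) (i : ℕ) :
    ∫ ω, X i i ω ^ 2 ∂P = 2 := by
  have h := (hX.law_diag i).integral_comp (f := fun x : ℝ => x ^ 2) (by fun_prop)
  simp only [Function.comp_def, hvar, div_pow] at h
  rw [integral_div] at h
  norm_num at h
  linarith

/-- In each Leibniz term a given independent entry occurs at most twice, at the positions `(i, j)`
and `(j, i)`. Grouping the factors by unordered pair therefore gives independent factors, each a
product of at most two `L⁴` functions and so in `L²`. The affine form with coefficients `a`, `c`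
covers both determinants and adjugate entries. -/
lemma memLp_two_det_affine [IsProbabilityMeasure P] (hX : IsWignerArray P Q X)
    (hfourth : Integrable (fun x : ℝ => x ^ 4) Q) {n : ℕ} {e : Fin n → ℕ}
    (he : Function.Injective e) (a c : Matrix (Fin n) (Fin n) ℝ) :
    MemLp (fun ω => (Matrix.of fun i j => a i j * wignerSubmatrix X e ω i j + c i j).det) 2 P := by
  classical
  simp only [Matrix.det_apply', wignerSubmatrix, Matrix.of_apply]
  refine memLp_finsetSum _ fun σ _ => MemLp.const_mul ?_ _
  let ψ (p : {p : ℕ × ℕ // p.1 ≤ p.2}) (y : ℝ) : ℝ :=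
    ∏ i with sortedPair (e (σ i)) (e i) = p, (a (σ i) i * y + c (σ i) i)
  have hψ (ω : Ω) : ∏ i, (a (σ i) i * X (e (σ i)) (e i) ω + c (σ i) i) =
      ∏ p ∈ Finset.univ.image (fun i => sortedPair (e (σ i)) (e i)), ψ p (X p.1.1 p.1.2 ω) := by
    rw [← Finset.prod_fiberwise_of_maps_to (s := Finset.univ)
      (g := fun i => sortedPair (e (σ i)) (e i)) (fun i hi => Finset.mem_image_of_mem _ hi)]
    refine Finset.prod_congr rfl fun p _ => Finset.prod_congr rfl fun i hi => ?_
    rw [hX.eq_sortedPair (e (σ i)) (e i), (Finset.mem_filter.1 hi).2]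
  simp only [hψ]
  refine memLp_two_prod_of_iIndepFun
    (Y := fun (p : {p : ℕ × ℕ // p.1 ≤ p.2}) ω => ψ p (X p.1.1 p.1.2 ω))
    (hX.indep.comp ψ fun p => by fun_prop) (fun p => ?_) _
  -- Membership in the fibre forces `e i` to be one of the two components of `p`, and `e` is
  -- injective.
  have hcard : (Finset.univ.filter fun i => sortedPair (e (σ i)) (e i) = p).card ≤ 2 := by
    rw [← Finset.card_image_of_injective _ he]
    refine (Finset.card_le_card (t := {p.1.1, p.1.2}) fun k hk => ?_).trans Finset.card_le_two
    obtain ⟨i, hi, rfl⟩ := Finset.mem_image.1 hk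
    rw [← (Finset.mem_filter.1 hi).2]
    rcases le_total (e (σ i)) (e i) with h | h <;> simp [sortedPair, h]
  have h4 (i : Fin n) : MemLp (fun ω => a (σ i) i * X p.1.1 p.1.2 ω + c (σ i) i) 4 P :=
    ((hX.memLp_four_entry hfourth _ _).const_mul _).add (memLp_const _)
  change MemLp (fun ω => ∏ i with sortedPair (e (σ i)) (e i) = p,
    (a (σ i) i * X p.1.1 p.1.2 ω + c (σ i) i)) 2 P
  generalize Finset.univ.filter (fun i => sortedPair (e (σ i)) (e i) = p) = s at hcard
  interval_cases h : s.card
  · rw [Finset.card_eq_zero.1 h]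
    simpa using memLp_const (1 : ℝ)
  · obtain ⟨i, rfl⟩ := Finset.card_eq_one.1 h
    simpa using (h4 i).mono_exponent (by norm_num)
  · obtain ⟨i, j, hij, rfl⟩ := Finset.card_eq_two.1 h
    simp only [Finset.prod_pair hij]
    exact memLp_two_mul_of_memLp_four (h4 i) (h4 j)

/-- Every pair indexing the row contains `e 0`, and no pair indexing the minor does, so the two
families use disjoint sets of independent entries. -/
lemma indepFun_submatrix_row (hX : IsWignerArray P Q X)
    (hfourth : Integrable (fun x : ℝ => x ^ 4) Q) {n : ℕ} {e : Fin (n + 1) → ℕ}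
    (he : Function.Injective e) :
    IndepFun (fun ω (i j : Fin n) => wignerSubmatrix X (e ∘ Fin.succ) ω i j)
      (fun ω (i : Fin (n + 1)) => X (e 0) (e i) ω) P := by
  classical
  let S : Finset {p : ℕ × ℕ // p.1 ≤ p.2} :=
    Finset.univ.image fun q : Fin n × Fin n => sortedPair (e q.1.succ) (e q.2.succ)
  let T : Finset {p : ℕ × ℕ // p.1 ≤ p.2} := Finset.univ.image fun i => sortedPair (e 0) (e i)
  have hST : Disjoint S T := by
    rw [Finset.disjoint_left]
    intro p hS hT
    obtain ⟨⟨i, j⟩, -, rfl⟩ := Finset.mem_image.1 hS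
    obtain ⟨k, -, hk⟩ := Finset.mem_image.1 hT
    have hi : e 0 ≠ e i.succ := fun h => (Fin.succ_ne_zero i) (he h).symm
    have hj : e 0 ≠ e j.succ := fun h => (Fin.succ_ne_zero j) (he h).symm
    simp only [sortedPair, Subtype.mk.injEq, Prod.mk.injEq] at hk
    omega
  have h := hX.indep.indepFun_finset₀ S T hST fun p => hX.aemeasurable_entry hfourth _ _
  have hF : Measurable fun (t : S → ℝ) (i j : Fin n) =>
      t ⟨sortedPair (e i.succ) (e j.succ), Finset.mem_image.2 ⟨(i, j), Finset.mem_univ _, rfl⟩⟩ := by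
    fun_prop
  have hG : Measurable fun (t : T → ℝ) (i : Fin (n + 1)) =>
      t ⟨sortedPair (e 0) (e i), Finset.mem_image.2 ⟨i, Finset.mem_univ _, rfl⟩⟩ := by
    fun_prop
  have h' := h.comp hF hG
  convert h' using 1
  · ext ω i j
    simp [wignerSubmatrix, hX.eq_sortedPair (e i.succ)]
  · ext ω i
    simp [hX.eq_sortedPair (e 0) (e i)]

lemma iIndepFun_row (hX : IsWignerArray P Q X) {n : ℕ} {e : Fin (n + 1) → ℕ}
    (he : Function.Injective e) : iIndepFun (fun i : Fin (n + 1) => X (e 0) (e i)) P := by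
  have hinj : Function.Injective fun i : Fin (n + 1) => sortedPair (e 0) (e i) := by
    intro i j hij
    simp only [sortedPair, Subtype.mk.injEq, Prod.mk.injEq] at hij
    exact he (by omega)
  convert hX.indep.precomp hinj using 2 with i
  exact hX.eq_sortedPair _ _

end IsWignerArray

/-! ### Determinant and adjugate identities. -/

namespace Matrix

/-- Laplace expansion along the first row, then along the first column of each remaining minor. It
isolates the dependence on the first row and column as an affine term and a quadratic form. -/
lemma det_fin_succ_eq_sub_sum_adjugate {R : Type*} [CommRing R] {n : ℕ}
    (Y : Matrix (Fin (n + 1)) (Fin (n + 1)) R) :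
    Y.det = Y 0 0 * (Y.submatrix Fin.succ Fin.succ).det -
      ∑ j : Fin n, ∑ i : Fin n, Y 0 j.succ * Y i.succ 0 *
        (Y.submatrix Fin.succ Fin.succ).adjugate j i := by
  rw [det_succ_row_zero, Fin.sum_univ_succ, sub_eq_add_neg, ← Finset.sum_neg_distrib]
  congr 1
  · simp [Fin.succAbove_zero]
  · refine Finset.sum_congr rfl fun j _ => ?_
    cases n with
    | zero => exact j.elim0
    | succ m =>
      rw [det_succ_column_zero, Finset.mul_sum, ← Finset.sum_neg_distrib]
      refine Finset.sum_congr rfl fun i _ => ?_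
      rw [adjugate_fin_succ_eq_det_submatrix]
      have h : ((Y.submatrix Fin.succ j.succ.succAbove).submatrix i.succAbove Fin.succ) =
          (Y.submatrix Fin.succ Fin.succ).submatrix i.succAbove j.succAbove := by
        ext k l
        simp
      rw [h]
      simp [pow_add, pow_succ]
      ring

/-- Jacobi's formula: differentiating the Leibniz products factor by factor replaces column `j` by
`-e_j`. -/
lemma derivative_det_map_C_sub_X {R : Type*} [CommRing R] {n : Type*} [Fintype n]
    [DecidableEq n] (M : Matrix n n R) (x : R) :
    (Polynomial.derivative (M.map Polynomial.C - (Polynomial.X : Polynomial R) •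
      (1 : Matrix n n (Polynomial R))).det).eval x = -(M - x • (1 : Matrix n n R)).adjugate.trace := by
  have h (j : n) : (M - x • (1 : Matrix n n R)).adjugate j j =
      ((M - x • (1 : Matrix n n R)).updateCol j (Pi.single j 1)).det := by
    rw [← cramer_apply, cramer_eq_adjugate_mulVec]
    simp
  simp only [trace, diag_apply, h, det_apply', Polynomial.derivative_sum, Polynomial.eval_finsetSum,
    ← Finset.sum_neg_distrib]
  rw [Finset.sum_comm]
  refine Finset.sum_congr rfl fun σ _ => ?_
  rw [Polynomial.derivative_mul, Polynomial.derivative_intCast, zero_mul, zero_add,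
    Polynomial.derivative_prod_finset, Polynomial.eval_mul, Polynomial.eval_intCast,
    Polynomial.eval_finsetSum, Finset.sum_neg_distrib, ← Finset.mul_sum, ← mul_neg,
    ← Finset.sum_neg_distrib]
  congr 1
  refine Finset.sum_congr rfl fun j _ => ?_
  rw [← Finset.mul_prod_erase _ _ (Finset.mem_univ j), Polynomial.eval_mul, mul_comm, ← neg_mul,
    Polynomial.eval_prod]
  congr 1
  · by_cases hj : σ j = j
    · simp [hj]
    · simp [hj]
  · refine Finset.prod_congr rfl fun k hk => ?_
    have hk : k ≠ j := Finset.ne_of_mem_erase hk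
    by_cases hkk : σ k = k <;> simp [hk, hkk]

/-- The resolvent identity cleared of denominators: `adj A (B - A) adj B` is computed once with `B -
A = (x - y) I` and once with `A adj A = det A`, `B adj B = det B`. -/
lemma sub_mul_trace_adjugate_mul_adjugate {R : Type*} [CommRing R] {n : Type*} [Fintype n]
    [DecidableEq n] (M : Matrix n n R) (x y : R) :
    (x - y) * ((M - x • (1 : Matrix n n R)).adjugate * (M - y • (1 : Matrix n n R)).adjugate).trace =
      (M - y • (1 : Matrix n n R)).det * (M - x • (1 : Matrix n n R)).adjugate.trace -
      (M - x • (1 : Matrix n n R)).det * (M - y • (1 : Matrix n n R)).adjugate.trace := by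
  set A := M - x • (1 : Matrix n n R) with hA
  set B := M - y • (1 : Matrix n n R) with hB
  have h : (x - y) • (A.adjugate * B.adjugate) = A.adjugate * (B - A) * B.adjugate := by
    rw [show B - A = (x - y) • (1 : Matrix n n R) by rw [hA, hB, sub_smul]; abel]
    simp
  rw [← smul_eq_mul, ← trace_smul, h, mul_sub, sub_mul, adjugate_mul, mul_assoc, mul_adjugate,
    trace_sub]
  simp

end Matrix

/-! ### Means, and joint moments of independent centred variables. -/

/-- `f` is integrable with integral `x`. -/
def HasMean {Ω : Type*} [MeasurableSpace Ω] (P : Measure Ω) (f : Ω → ℝ) (x : ℝ) : Prop :=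
  Integrable f P ∧ ∫ ω, f ω ∂P = x

namespace HasMean

variable {Ω : Type*} [MeasurableSpace Ω] {P : Measure Ω} {f g : Ω → ℝ} {x y : ℝ}

lemma of_integrable (h : Integrable f P) : HasMean P f (∫ ω, f ω ∂P) := ⟨h, rfl⟩

lemma add (hf : HasMean P f x) (hg : HasMean P g y) : HasMean P (fun ω => f ω + g ω) (x + y) :=
  ⟨hf.1.add hg.1, by rw [integral_add hf.1 hg.1, hf.2, hg.2]⟩

lemma sub (hf : HasMean P f x) (hg : HasMean P g y) : HasMean P (fun ω => f ω - g ω) (x - y) :=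
  ⟨hf.1.sub hg.1, by rw [integral_sub hf.1 hg.1, hf.2, hg.2]⟩

lemma const_mul (c : ℝ) (hf : HasMean P f x) : HasMean P (fun ω => c * f ω) (c * x) :=
  ⟨hf.1.const_mul c, by rw [integral_const_mul, hf.2]⟩

lemma sum {ι : Type*} {s : Finset ι} {f : ι → Ω → ℝ} {x : ι → ℝ}
    (h : ∀ i ∈ s, HasMean P (f i) (x i)) : HasMean P (fun ω => ∑ i ∈ s, f i ω) (∑ i ∈ s, x i) :=
  ⟨integrable_finsetSum _ fun i hi => (h i hi).1, by
    rw [integral_finsetSum _ fun i hi => (h i hi).1]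
    exact Finset.sum_congr rfl fun i hi => (h i hi).2⟩

lemma mul_of_indepFun (hfg : IndepFun f g P) (hf : HasMean P f x) (hg : HasMean P g y) :
    HasMean P (fun ω => f ω * g ω) (x * y) :=
  ⟨hfg.integrable_mul hf.1 hg.1, by
    rw [hfg.integral_fun_mul_eq_mul_integral hf.1.1 hg.1.1, hf.2, hg.2]⟩

end HasMean

section Moments

variable {Ω ι : Type*} [MeasurableSpace Ω] {P : Measure Ω} {V : ι → Ω → ℝ}

lemma hasMean_mul_eq_zero_of_notMem [IsProbabilityMeasure P] (hV : iIndepFun V P)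
    (h4 : ∀ i, MemLp (V i) 4 P) (hmean : ∀ i, ∫ ω, V i ω ∂P = 0) {l : ι} {s : Finset ι}
    (hl : l ∉ s) {g : (s → ℝ) → ℝ} (hg : Measurable g)
    (hgi : Integrable (fun ω => g fun i => V i ω) P) :
    HasMean P (fun ω => V l ω * g fun i => V i ω) 0 := by
  have h := hV.indepFun_finset₀ {l} s (by simpa using hl) fun i => (h4 i).1.aemeasurable
  have hF : Measurable fun t : ({l} : Finset ι) → ℝ => t ⟨l, Finset.mem_singleton_self l⟩ := by
    fun_prop
  have h' := HasMean.mul_of_indepFun (h.comp hF hg)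
    ⟨(h4 l).integrable (by norm_num), hmean l⟩ (HasMean.of_integrable hgi)
  simpa using h'

lemma hasMean_mul_pair [IsProbabilityMeasure P] [DecidableEq ι] (hV : iIndepFun V P)
    (h4 : ∀ i, MemLp (V i) 4 P) (hmean : ∀ i, ∫ ω, V i ω ∂P = 0) (i j : ι)
    (hvar : ∫ ω, V i ω ^ 2 ∂P = 1) :
    HasMean P (fun ω => V i ω * V j ω) (if i = j then 1 else 0) := by
  split_ifs with h
  · subst h
    refine ⟨(memLp_two_mul_of_memLp_four (h4 i) (h4 i)).integrable (by norm_num), ?_⟩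
    simpa [sq] using hvar
  · have hg : Measurable fun t : ({j} : Finset ι) → ℝ => t ⟨j, Finset.mem_singleton_self j⟩ := by
      fun_prop
    exact hasMean_mul_eq_zero_of_notMem hV h4 hmean (l := i) (s := {j}) (by simpa using h) hg
      ((h4 j).integrable (by norm_num))

lemma hasMean_mul_pair_of_ne [IsProbabilityMeasure P] [DecidableEq ι] (hV : iIndepFun V P)
    (h4 : ∀ i, MemLp (V i) 4 P) (hmean : ∀ i, ∫ ω, V i ω ∂P = 0) {l i j : ι} (hi : l ≠ i)
    (hj : l ≠ j) : HasMean P (fun ω => V l ω * (V i ω * V j ω)) 0 := by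
  have hg : Measurable fun t : ({i, j} : Finset ι) → ℝ =>
      t ⟨i, by simp⟩ * t ⟨j, by simp⟩ := by
    fun_prop
  exact hasMean_mul_eq_zero_of_notMem hV h4 hmean (l := l) (s := {i, j}) (by simp [hi, hj]) hg
    ((memLp_two_mul_of_memLp_four (h4 i) (h4 j)).integrable (by norm_num))

lemma hasMean_mul_triple_of_ne [IsProbabilityMeasure P] [DecidableEq ι] (hV : iIndepFun V P)
    (h4 : ∀ i, MemLp (V i) 4 P) (hmean : ∀ i, ∫ ω, V i ω ∂P = 0) {l i j k : ι} (hi : l ≠ i)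
    (hj : l ≠ j) (hk : l ≠ k) : HasMean P (fun ω => V l ω * (V i ω * V j ω * V k ω)) 0 := by
  have hg : Measurable fun t : ({i, j, k} : Finset ι) → ℝ =>
      t ⟨i, by simp⟩ * t ⟨j, by simp⟩ * t ⟨k, by simp⟩ := by
    fun_prop
  exact hasMean_mul_eq_zero_of_notMem hV h4 hmean (l := l) (s := {i, j, k}) (by simp [hi, hj, hk])
    hg ((memLp_two_mul_of_memLp_four (h4 i) (h4 j)).integrable_mul
      (MemLp.mono_exponent (p := 2) (h4 k) (by norm_num)))

/-- Wick's formula with its correction: the three pairings give `3` when all indices agree, so the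
fourth cumulant `b - 3` is added there. If some index differs from the three others, the mean is
zero. -/
lemma hasMean_mul_quadruple [IsProbabilityMeasure P] [DecidableEq ι] (hV : iIndepFun V P)
    (h4 : ∀ i, MemLp (V i) 4 P) (hmean : ∀ i, ∫ ω, V i ω ∂P = 0)
    (hvar : ∀ i, ∫ ω, V i ω ^ 2 ∂P = 1) {b : ℝ} (hb : ∀ i, ∫ ω, V i ω ^ 4 ∂P = b) (i j k l : ι) :
    HasMean P (fun ω => V i ω * V j ω * (V k ω * V l ω))
      ((if i = j then 1 else 0) * (if k = l then 1 else 0) +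
        (if i = k then 1 else 0) * (if j = l then 1 else 0) +
        (if i = l then 1 else 0) * (if j = k then 1 else 0) +
        (b - 3) * ((if i = j then 1 else 0) * (if i = k then 1 else 0) *
          (if i = l then 1 else 0))) := by
  have hsq {i k : ι} (h : i ≠ k) : HasMean P (fun ω => V i ω * V i ω * (V k ω * V k ω)) 1 := by
    have h0 (i : ι) : HasMean P (fun ω => V i ω * V i ω) 1 := by
      simpa using hasMean_mul_pair hV h4 hmean i i (hvar i)
    have hm : Measurable fun x : ℝ => x * x := by fun_prop
    simpa using HasMean.mul_of_indepFun ((hV.indepFun h).comp hm hm) (h0 i) (h0 k)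
  have h1 {l i j k : ι} (hi : l ≠ i) (hj : l ≠ j) (hk : l ≠ k) :=
    hasMean_mul_triple_of_ne hV h4 hmean hi hj hk
  by_cases hij : i = j
  · subst hij
    by_cases hkl : k = l
    · subst hkl
      by_cases hik : i = k
      · subst hik
        refine ⟨(memLp_two_mul_of_memLp_four (h4 i) (h4 i)).integrable_mul
          (memLp_two_mul_of_memLp_four (h4 i) (h4 i)), ?_⟩
        simp only [if_true]
        rw [show 1 * 1 + 1 * 1 + 1 * 1 + (b - 3) * (1 * 1 * 1) = b by ring, ← hb i]
        congr 1 with ω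
        ring
      · simpa [hik] using hsq hik
    · by_cases hik : i = k
      · subst hik
        have hil : l ≠ i := Ne.symm hkl
        convert h1 hil hil hil using 1
        · ext ω; ring
        · simp [hkl]
      · convert h1 (Ne.symm hik) (Ne.symm hik) hkl using 1
        · ext ω; ring
        · simp [hik, hkl]
  · by_cases hik : i = k
    · subst hik
      by_cases hjl : j = l
      · subst hjl
        convert hsq hij using 1
        · ext ω; ring
        · simp [hij]
      · convert h1 (Ne.symm hij) (Ne.symm hij) hjl using 1
        · ext ω; ring
        · simp [hij, hjl, Ne.symm hij]
    · by_cases hil : i = l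
      · subst hil
        by_cases hjk : j = k
        · subst hjk
          convert hsq hij using 1
          · ext ω; ring
          · simp [hij]
        · convert h1 (Ne.symm hij) (Ne.symm hij) hjk using 1
          · ext ω; ring
          · simp [hij, hjk, Ne.symm hij]
      · convert h1 hij hik hil using 1
        · ext ω; ring
        · simp [hij, hik, hil]

end Moments

lemma sum_pairing_mul {ι : Type*} [Fintype ι] [DecidableEq ι] (c : ℝ) (m : ι → ι → ι → ι → ℝ) :
    ∑ j, ∑ i, ∑ l, ∑ k, ((if j = i then 1 else 0) * (if l = k then 1 else 0) +
        (if j = l then 1 else 0) * (if i = k then 1 else 0) +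
        (if j = k then 1 else 0) * (if i = l then 1 else 0) +
        c * ((if j = i then 1 else 0) * (if j = l then 1 else 0) *
          (if j = k then 1 else 0))) * m j i l k =
      ∑ j, ∑ l, m j j l l + ∑ j, ∑ i, m j i j i + ∑ j, ∑ i, m j i i j + c * ∑ j, m j j j j := by
  simp [add_mul, Finset.sum_add_distrib, Finset.mul_sum]

/-! ### Averaging over the first row. -/

namespace IsWignerArray

variable {Ω : Type*} [MeasurableSpace Ω] {P : Measure Ω} [IsProbabilityMeasure P]
  {Q : Measure ℝ} {X : ℕ → ℕ → Ω → ℝ}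

lemma memLp_two_det_sub_smul (hX : IsWignerArray P Q X)
    (hfourth : Integrable (fun x : ℝ => x ^ 4) Q) {n : ℕ} {e : Fin n → ℕ}
    (he : Function.Injective e) (x : ℝ) :
    MemLp (fun ω => (wignerSubmatrix X e ω - x • (1 : Matrix (Fin n) (Fin n) ℝ)).det) 2 P := by
  convert hX.memLp_two_det_affine hfourth he (Matrix.of fun _ _ => 1)
    (-(x • (1 : Matrix (Fin n) (Fin n) ℝ))) using 4 with ω
  ext i j
  simp [sub_eq_add_neg]

lemma memLp_two_adjugate_sub_smul (hX : IsWignerArray P Q X)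
    (hfourth : Integrable (fun x : ℝ => x ^ 4) Q) {n : ℕ} {e : Fin n → ℕ}
    (he : Function.Injective e) (x : ℝ) (j i : Fin n) :
    MemLp (fun ω =>
      (wignerSubmatrix X e ω - x • (1 : Matrix (Fin n) (Fin n) ℝ)).adjugate j i) 2 P := by
  simp only [Matrix.adjugate_apply]
  -- An adjugate entry is the determinant with row `i` replaced by a basis vector, which is affine
  -- in the entries with coefficient `0` on that row.
  convert hX.memLp_two_det_affine hfourth he (Matrix.updateRow (Matrix.of fun _ _ => 1) i 0)
    (Matrix.updateRow (-(x • (1 : Matrix (Fin n) (Fin n) ℝ))) i (Pi.single j 1)) using 4 with ω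
  ext k l
  by_cases hk : k = i
  · subst hk; simp
  · simp [hk, sub_eq_add_neg]

/-- With `v` the off-diagonal part of the first row, each determinant is `(X₀₀ - z) det A - vᵀ
adj(A) v`. The constant `2` in `2 + x * y` is the variance of the diagonal entry. The terms with one
trace come from `E v vᵀ = I`, and the last three from the fourth moments of `v`. -/
lemma hasMean_det_mul_det_succ (hX : IsWignerArray P Q X)
    (hmean : ∫ x, x ∂Q = 0) (hvar : ∫ x, x ^ 2 ∂Q = 1)
    (hfourth : Integrable (fun x : ℝ => x ^ 4) Q) {b : ℝ} (hb : b = ∫ x, x ^ 4 ∂Q)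
    {n : ℕ} {e : Fin (n + 1) → ℕ} (he : Function.Injective e) (x y : ℝ) :
    HasMean P (fun ω =>
        (wignerSubmatrix X e ω - x • (1 : Matrix (Fin (n + 1)) (Fin (n + 1)) ℝ)).det *
        (wignerSubmatrix X e ω - y • (1 : Matrix (Fin (n + 1)) (Fin (n + 1)) ℝ)).det)
      (∫ ω,
        (let A := wignerSubmatrix X (e ∘ Fin.succ) ω - x • (1 : Matrix (Fin n) (Fin n) ℝ)
         let B := wignerSubmatrix X (e ∘ Fin.succ) ω - y • (1 : Matrix (Fin n) (Fin n) ℝ)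
         (2 + x * y) * (A.det * B.det) + x * (A.det * B.adjugate.trace) +
          y * (A.adjugate.trace * B.det) + A.adjugate.trace * B.adjugate.trace +
          2 * (A.adjugate * B.adjugate).trace +
          (b - 3) * ∑ i, A.adjugate i i * B.adjugate i i) ∂P) := by
  have he' : Function.Injective (e ∘ Fin.succ) := he.comp (Fin.succ_injective n)
  have hind := hX.indepFun_submatrix_row hfourth he
  have hw := hX.iIndepFun_row he
  have hv : iIndepFun (fun i : Fin n => X (e 0) (e i.succ)) P := hw.precomp (Fin.succ_injective n)
  have hw4 (i : Fin (n + 1)) : MemLp (X (e 0) (e i)) 4 P := hX.memLp_four_entry hfourth _ _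
  have hw0 (i : Fin (n + 1)) : ∫ ω, X (e 0) (e i) ω ∂P = 0 := hX.integral_entry hmean _ _
  have hne (i : Fin n) : e 0 ≠ e i.succ := fun h => (Fin.succ_ne_zero i) (he h).symm
  have hv2 (i : Fin n) : ∫ ω, X (e 0) (e i.succ) ω ^ 2 ∂P = 1 := by
    rw [hX.integral_entry_pow (hne i), hvar]
  have hv4 (i : Fin n) : ∫ ω, X (e 0) (e i.succ) ω ^ 4 ∂P = b := by
    rw [hX.integral_entry_pow (hne i), hb]
  let M (ω : Ω) : Matrix (Fin n) (Fin n) ℝ := wignerSubmatrix X (e ∘ Fin.succ) ω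
  let A (ω : Ω) := (M ω - x • (1 : Matrix (Fin n) (Fin n) ℝ))
  let B (ω : Ω) := (M ω - y • (1 : Matrix (Fin n) (Fin n) ℝ))
  have hdA : MemLp (fun ω => (A ω).det) 2 P := hX.memLp_two_det_sub_smul hfourth he' x
  have hdB : MemLp (fun ω => (B ω).det) 2 P := hX.memLp_two_det_sub_smul hfourth he' y
  have hA (j i : Fin n) : MemLp (fun ω => (A ω).adjugate j i) 2 P :=
    hX.memLp_two_adjugate_sub_smul hfourth he' x j i
  have hB (j i : Fin n) : MemLp (fun ω => (B ω).adjugate j i) 2 P :=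
    hX.memLp_two_adjugate_sub_smul hfourth he' y j i
  have hmdet (x : ℝ) : Measurable fun N : Fin n → Fin n → ℝ =>
      (Matrix.of N - x • (1 : Matrix (Fin n) (Fin n) ℝ)).det := by
    apply Continuous.measurable
    exact Continuous.matrix_det (by fun_prop)
  have hmadj (x : ℝ) (j i : Fin n) : Measurable fun N : Fin n → Fin n → ℝ =>
      (Matrix.of N - x • (1 : Matrix (Fin n) (Fin n) ℝ)).adjugate j i := by
    apply Continuous.measurable
    exact (Continuous.matrix_adjugate (by fun_prop)).matrix_elem j i
  have key {V : (Fin (n + 1) → ℝ) → ℝ} {F : (Fin n → Fin n → ℝ) → ℝ} {t : ℝ} (hV : Measurable V)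
      (hF : Measurable F) (h1 : HasMean P (fun ω => V fun i => X (e 0) (e i) ω) t)
      (h2 : Integrable (fun ω => F fun i j => M ω i j) P) :
      HasMean P (fun ω => V (fun i => X (e 0) (e i) ω) * F fun i j => M ω i j)
        (t * ∫ ω, (F fun i j => M ω i j) ∂P) :=
    HasMean.mul_of_indepFun (hind.comp hF hV).symm h1 (HasMean.of_integrable h2)
  -- expectations of the monomials of the first row
  have e2 : HasMean P (fun ω => X (e 0) (e 0) ω ^ 2) 2 :=
    ⟨((hw4 0).mono_exponent (by norm_num)).integrable_sq, hX.integral_diag_sq hvar _⟩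
  have e1 : HasMean P (fun ω => X (e 0) (e 0) ω) 0 := ⟨(hw4 0).integrable (by norm_num), hw0 0⟩
  have evv (j i : Fin n) := hasMean_mul_pair hv (fun i => hw4 i.succ) (fun i => hw0 i.succ) j i (hv2 j)
  have ecvv (j i : Fin n) := hasMean_mul_pair_of_ne hw hw4 hw0 (l := 0) (Fin.succ_ne_zero j).symm
    (Fin.succ_ne_zero i).symm
  have evvvv := hasMean_mul_quadruple hv (fun i => hw4 i.succ) (fun i => hw0 i.succ) hv2 hv4
  -- expectations of the terms of the product
  have iDD := hdA.integrable_mul hdB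
  have iDB (j i : Fin n) := hdA.integrable_mul (hB j i)
  have iAD (j i : Fin n) := (hA j i).integrable_mul hdB
  have iAB (j i l k : Fin n) := (hA j i).integrable_mul (hB l k)
  have t1 := key (V := fun w => w 0 ^ 2) (by fun_prop) ((hmdet x).mul (hmdet y)) e2 iDD
  have t2 := key (V := fun w => w 0) (by fun_prop) ((hmdet x).mul (hmdet y)) e1 iDD
  have t3 := HasMean.of_integrable iDD
  have t4 (j i : Fin n) := key (V := fun w => w 0 * (w j.succ * w i.succ)) (by fun_prop)
    ((hmdet x).mul (hmadj y j i)) (ecvv j i) (iDB j i)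
  have t5 (j i : Fin n) := key (V := fun w => w 0 * (w j.succ * w i.succ)) (by fun_prop)
    ((hmadj x j i).mul (hmdet y)) (ecvv j i) (iAD j i)
  have t6 (j i : Fin n) := key (V := fun w => w j.succ * w i.succ) (by fun_prop)
    ((hmdet x).mul (hmadj y j i)) (evv j i) (iDB j i)
  have t7 (j i : Fin n) := key (V := fun w => w j.succ * w i.succ) (by fun_prop)
    ((hmadj x j i).mul (hmdet y)) (evv j i) (iAD j i)
  have t8 (j i l k : Fin n) := key
    (V := fun w => w j.succ * w i.succ * (w l.succ * w k.succ)) (by fun_prop)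
    ((hmadj x j i).mul (hmadj y l k)) (evvvv j i l k) (iAB j i l k)
  have lhs := (((((((t1.sub (t2.const_mul (x + y))).add (t3.const_mul (x * y))).sub
    (HasMean.sum (s := .univ) fun j _ => HasMean.sum (s := .univ) fun i _ => t4 j i)).sub
    (HasMean.sum (s := .univ) fun j _ => HasMean.sum (s := .univ) fun i _ => t5 j i)).add
    ((HasMean.sum (s := .univ) fun j _ => HasMean.sum (s := .univ) fun i _ => t6 j i).const_mul
      x)).add
    ((HasMean.sum (s := .univ) fun j _ => HasMean.sum (s := .univ) fun i _ => t7 j i).const_mul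
      y)).add
    (HasMean.sum (s := .univ) fun j _ => HasMean.sum (s := .univ) fun i _ =>
      HasMean.sum (s := .univ) fun l _ => HasMean.sum (s := .univ) fun k _ => t8 j i l k))
  have rhs := ((((((t3.const_mul (2 + x * y)).add
    ((HasMean.sum (s := .univ) fun j _ => HasMean.of_integrable (iDB j j)).const_mul x)).add
    ((HasMean.sum (s := .univ) fun j _ => HasMean.of_integrable (iAD j j)).const_mul y)).add
    (HasMean.sum (s := .univ) fun j _ => HasMean.sum (s := .univ) fun l _ =>
      HasMean.of_integrable (iAB j j l l))).add
    ((HasMean.sum (s := .univ) fun j _ => HasMean.sum (s := .univ) fun i _ =>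
      HasMean.of_integrable (iAB j i i j)).const_mul 2)).add
    ((HasMean.sum (s := .univ) fun j _ => HasMean.of_integrable (iAB j j j j)).const_mul (b - 3)))
  -- Symmetry makes the two crossed pairings equal, whence the factor `2` before the trace of the
  -- product.
  have hsymm (ω : Ω) (j i : Fin n) : (B ω).adjugate j i = (B ω).adjugate i j := by
    have h : (B ω).IsSymm := by
      ext j i
      simp [B, M, wignerSubmatrix, hX.symm (e i.succ), Matrix.one_apply, eq_comm]
    exact (h.adjugate.apply i j)
  have hexp (z : ℝ) (ω : Ω) :
      (wignerSubmatrix X e ω - z • (1 : Matrix (Fin (n + 1)) (Fin (n + 1)) ℝ)).det =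
      (X (e 0) (e 0) ω - z) * (M ω - z • (1 : Matrix (Fin n) (Fin n) ℝ)).det -
      ∑ j : Fin n, ∑ i : Fin n, X (e 0) (e j.succ) ω * X (e 0) (e i.succ) ω *
        (M ω - z • (1 : Matrix (Fin n) (Fin n) ℝ)).adjugate j i := by
    have h : (wignerSubmatrix X e ω - z • (1 : Matrix (Fin (n + 1)) (Fin (n + 1)) ℝ)).submatrix
        Fin.succ Fin.succ = M ω - z • (1 : Matrix (Fin n) (Fin n) ℝ) := by
      ext i j
      simp [M, wignerSubmatrix, Matrix.one_apply]
    rw [Matrix.det_fin_succ_eq_sub_sum_adjugate, h]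
    simp [wignerSubmatrix, hX.symm _ (e 0), Fin.succ_ne_zero,
      (Fin.succ_ne_zero _).symm]
  convert lhs using 1
  · ext ω
    simp only [hexp x, hexp y]
    set c := X (e 0) (e 0) ω
    set v : Fin n → ℝ := fun j => X (e 0) (e j.succ) ω
    set dA := (A ω).det
    set dB := (B ω).det
    set SA := ∑ j, ∑ i, v j * v i * (A ω).adjugate j i with hSA
    set SB := ∑ j, ∑ i, v j * v i * (B ω).adjugate j i with hSB
    have s4 : ∑ j, ∑ i, c * (v j * v i) * (dA * (B ω).adjugate j i) = c * dA * SB := by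
      simp only [hSB, Finset.mul_sum]
      exact Finset.sum_congr rfl fun j _ => Finset.sum_congr rfl fun i _ => by ring
    have s5 : ∑ j, ∑ i, c * (v j * v i) * ((A ω).adjugate j i * dB) = c * dB * SA := by
      simp only [hSA, Finset.mul_sum]
      exact Finset.sum_congr rfl fun j _ => Finset.sum_congr rfl fun i _ => by ring
    have s6 : ∑ j, ∑ i, v j * v i * (dA * (B ω).adjugate j i) = dA * SB := by
      simp only [hSB, Finset.mul_sum]
      exact Finset.sum_congr rfl fun j _ => Finset.sum_congr rfl fun i _ => by ring
    have s7 : ∑ j, ∑ i, v j * v i * ((A ω).adjugate j i * dB) = dB * SA := by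
      simp only [hSA, Finset.mul_sum]
      exact Finset.sum_congr rfl fun j _ => Finset.sum_congr rfl fun i _ => by ring
    have s8 : ∑ j, ∑ i, ∑ l, ∑ k, v j * v i * (v l * v k) *
        ((A ω).adjugate j i * (B ω).adjugate l k) = SA * SB := by
      simp only [hSA, Finset.sum_mul]
      refine Finset.sum_congr rfl fun j _ => Finset.sum_congr rfl fun i _ => ?_
      simp only [hSB, Finset.mul_sum]
      exact Finset.sum_congr rfl fun l _ => Finset.sum_congr rfl fun k _ => by ring
    change ((c - x) * dA - SA) * ((c - y) * dB - SB) = c ^ 2 * (dA * dB) -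
      (x + y) * (c * (dA * dB)) + x * y * (dA * dB) -
      ∑ j, ∑ i, c * (v j * v i) * (dA * (B ω).adjugate j i) -
      ∑ j, ∑ i, c * (v j * v i) * ((A ω).adjugate j i * dB) +
      x * ∑ j, ∑ i, v j * v i * (dA * (B ω).adjugate j i) +
      y * ∑ j, ∑ i, v j * v i * ((A ω).adjugate j i * dB) +
      ∑ j, ∑ i, ∑ l, ∑ k, v j * v i * (v l * v k) * ((A ω).adjugate j i * (B ω).adjugate l k)
    rw [s4, s5, s6, s7, s8]
    ring
  · rw [← (rhs.2.symm.trans (integral_congr_ae (ae_of_all _ fun ω => ?_)))]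
    · have hI (j i : Fin n) : ∫ ω, (A ω).adjugate j i * (B ω).adjugate j i ∂P =
          ∫ ω, (A ω).adjugate j i * (B ω).adjugate i j ∂P :=
        integral_congr_ae (ae_of_all _ fun ω => by simp only [hsymm ω j i])
      have h6 : ∑ j : Fin n, ∑ i : Fin n, (if j = i then 1 else 0) *
          ∫ ω, (A ω).det * (B ω).adjugate j i ∂P =
          ∑ j : Fin n, ∫ ω, (A ω).det * (B ω).adjugate j j ∂P := by simp
      have h7 : ∑ j : Fin n, ∑ i : Fin n, (if j = i then 1 else 0) *
          ∫ ω, (A ω).adjugate j i * (B ω).det ∂P =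
          ∑ j : Fin n, ∫ ω, (A ω).adjugate j j * (B ω).det ∂P := by simp
      have h8 := sum_pairing_mul (b - 3) fun j i l k : Fin n =>
        ∫ ω, (A ω).adjugate j i * (B ω).adjugate l k ∂P
      have h9 : ∑ j, ∑ i, ∫ ω, (A ω).adjugate j i * (B ω).adjugate j i ∂P =
          ∑ j, ∑ i, ∫ ω, (A ω).adjugate j i * (B ω).adjugate i j ∂P :=
        Finset.sum_congr rfl fun j _ => Finset.sum_congr rfl fun i _ => hI j i
      refine Eq.trans ?_ (congrArg₂ (· + ·) (congrArg₂ (· + ·) (congrArg₂ (· + ·) rfl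
        (congrArg (x * ·) h6.symm)) (congrArg (y * ·) h7.symm)) h8.symm)
      simp only [zero_mul, Finset.sum_const_zero]
      refine Eq.trans ?_ (congrArg₂ (· + ·) rfl (congrArg (· + _)
        (congrArg (· + _) (congrArg (_ + ·) h9.symm))))
      have h10 (D S T U V W : ℝ) : (2 + x * y) * D + x * S + y * T + U + 2 * V + (b - 3) * W =
          2 * D - (x + y) * 0 + x * y * D - 0 - 0 + x * S + y * T + (U + V + V + (b - 3) * W) := by
        ring
      exact h10 _ _ _ _ _ _
    · change (2 + x * y) * ((A ω).det * (B ω).det) + x * (∑ j, (A ω).det * (B ω).adjugate j j) +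
        y * (∑ j, (A ω).adjugate j j * (B ω).det) +
        ∑ j, ∑ l, (A ω).adjugate j j * (B ω).adjugate l l +
        2 * (∑ j, ∑ i, (A ω).adjugate j i * (B ω).adjugate i j) +
        (b - 3) * ∑ j, (A ω).adjugate j j * (B ω).adjugate j j =
        (2 + x * y) * ((A ω).det * (B ω).det) + x * ((A ω).det * (B ω).adjugate.trace) +
        y * ((A ω).adjugate.trace * (B ω).det) + (A ω).adjugate.trace * (B ω).adjugate.trace +
        2 * ((A ω).adjugate * (B ω).adjugate).trace +
        (b - 3) * ∑ j, (A ω).adjugate j j * (B ω).adjugate j j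
      simp only [Matrix.trace, Matrix.diag_apply, Matrix.mul_apply, Finset.mul_sum, Finset.sum_mul]
      rw [Finset.sum_comm (f := fun j l => (A ω).adjugate j j * (B ω).adjugate l l)]

end IsWignerArray

/-! ### Linear functionals of random polynomials. -/

section RandomPolynomial

open Polynomial

lemma Polynomial.linearMap_apply_eq_sum_eval {n : ℕ} {p : ℝ[X]} (hp : p.natDegree ≤ n)
    (ℓ : ℝ[X] →ₗ[ℝ] ℝ) :
    ℓ p = ∑ i ∈ Finset.range (n + 1), ℓ (Lagrange.basis (Finset.range (n + 1))
      (fun i : ℕ => (i : ℝ)) i) * p.eval (i : ℝ) := by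
  conv_lhs => rw [Lagrange.eq_interpolate (s := Finset.range (n + 1)) (v := fun i : ℕ => (i : ℝ))
    (f := p) Nat.cast_injective.injOn
    (degree_le_natDegree.trans_lt (by
      rw [Finset.card_range]; exact_mod_cast Nat.lt_succ_of_le hp))]
  rw [Lagrange.interpolate_apply, map_sum]
  exact Finset.sum_congr rfl fun i _ => by
    rw [← smul_eq_C_mul, map_smul, smul_eq_mul, mul_comm]

variable {Ω : Type*} [MeasurableSpace Ω] {P : Measure Ω} {n : ℕ} {p : Ω → ℝ[X]}

/-- On polynomials of degree at most `n` every linear functional is a fixed combination of the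
evaluations at `0, …, n`. Derivatives in `x` and `y` thus pass through the expectation without any
differentiation under the integral. -/
lemma hasMean_linearMap_mul_linearMap (hp : ∀ ω, (p ω).natDegree ≤ n) {s : Finset ℕ} {w : ℕ → ℝ}
    {H : ℕ → ℝ[X]} (hH : ∀ k ∈ s, (H k).natDegree ≤ n)
    (h : ∀ x y, HasMean P (fun ω => (p ω).eval x * (p ω).eval y)
      (∑ k ∈ s, w k * ((H k).eval x * (H k).eval y))) (ℓ m : ℝ[X] →ₗ[ℝ] ℝ) :
    HasMean P (fun ω => ℓ (p ω) * m (p ω)) (∑ k ∈ s, w k * (ℓ (H k) * m (H k))) := by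
  have hfun (q r : ℝ[X]) (hq : q.natDegree ≤ n) (hr : r.natDegree ≤ n) := by
    have h1 := linearMap_apply_eq_sum_eval hq ℓ
    have h2 := linearMap_apply_eq_sum_eval hr m
    exact congrArg₂ (· * ·) h1 h2
  have key (i j : ℕ) := (h i j).const_mul
    (ℓ (Lagrange.basis (Finset.range (n + 1)) (fun i : ℕ => (i : ℝ)) i) *
      m (Lagrange.basis (Finset.range (n + 1)) (fun i : ℕ => (i : ℝ)) j))
  convert HasMean.sum (s := Finset.range (n + 1)) fun i _ =>
    HasMean.sum (s := Finset.range (n + 1)) fun j _ => key i j using 1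
  · ext ω
    refine (hfun _ _ (hp ω) (hp ω)).trans ?_
    simp only [Finset.sum_mul_sum]
    exact Finset.sum_congr rfl fun i _ => Finset.sum_congr rfl fun j _ => by ring
  · simp only [Finset.mul_sum]
    refine Eq.trans (Finset.sum_congr rfl fun k hk => ?_)
      (Finset.sum_comm.trans (Finset.sum_congr rfl fun i _ => Finset.sum_comm))
    refine (congrArg (w k * ·) (hfun _ _ (hH k hk) (hH k hk))).trans ?_
    rw [Finset.sum_mul_sum]
    simp only [Finset.mul_sum]
    exact Finset.sum_congr rfl fun i _ => Finset.sum_congr rfl fun j _ => by ring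

lemma continuous_integral_eval_mul {g : Ω → ℝ} (hp : ∀ ω, (p ω).natDegree ≤ n)
    (h : ∀ x, Integrable (fun ω => (p ω).eval x * g ω) P) :
    Continuous fun x => ∫ ω, (p ω).eval x * g ω ∂P := by
  have key (x : ℝ) : ∫ ω, (p ω).eval x * g ω ∂P = ∑ i ∈ Finset.range (n + 1),
      (Lagrange.basis (Finset.range (n + 1)) (fun i : ℕ => (i : ℝ)) i).eval x *
        ∫ ω, (p ω).eval (i : ℝ) * g ω ∂P := by
    have hsum := integral_finsetSum (μ := P) (Finset.range (n + 1)) (f := fun i ω =>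
      (Lagrange.basis (Finset.range (n + 1)) (fun i : ℕ => (i : ℝ)) i).eval x *
        ((p ω).eval (i : ℝ) * g ω)) fun i _ => (h i).const_mul _
    simp only [integral_const_mul] at hsum
    rw [← hsum]
    congr 1 with ω
    rw [show (p ω).eval x = leval x (p ω) from rfl, linearMap_apply_eq_sum_eval (hp ω),
      Finset.sum_mul]
    simp [mul_assoc]
  rw [funext key]
  fun_prop

end RandomPolynomial

/-! ### Hermite polynomials. -/

section Hermite

open Polynomial

/-- The probabilists' Hermite polynomials with real coefficients. -/
noncomputable def realHermite (k : ℕ) : ℝ[X] := (hermite k).map (Int.castRingHom ℝ)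

lemma realHermite_zero : realHermite 0 = 1 := by simp [realHermite]

lemma realHermite_succ (k : ℕ) :
    realHermite (k + 1) = X * realHermite k - derivative (realHermite k) := by
  simp [realHermite, hermite_succ, derivative_map]

lemma derivative_realHermite_succ (k : ℕ) :
    derivative (realHermite (k + 1)) = (k + 1 : ℝ) • realHermite k := by
  induction k with
  | zero => simp [realHermite_succ, realHermite_zero]
  | succ k ih =>
    rw [realHermite_succ (k + 1), derivative_sub, derivative_mul, ih, derivative_smul,
      derivative_X, one_mul, realHermite_succ k]
    simp only [smul_eq_C_mul]
    push_cast
    simp only [C_add, C_1]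
    ring

lemma natDegree_realHermite_le (k : ℕ) : (realHermite k).natDegree ≤ k :=
  natDegree_map_le.trans natDegree_hermite.le

/-- The `k`-th term `He_k(x) He_k(y) / k!` of Mehler's series. -/
noncomputable def mehlerTerm (x y : ℝ) (k : ℕ) : ℝ :=
  (realHermite k).eval x * (realHermite k).eval y / k !

lemma factorial_mul_mehlerTerm (x y : ℝ) (k : ℕ) :
    (k ! : ℝ) * mehlerTerm x y k = (realHermite k).eval x * (realHermite k).eval y := by
  have : (k ! : ℝ) ≠ 0 := by positivity
  rw [mehlerTerm]
  field_simp

/-- The Christoffel–Darboux formula for Hermite polynomials, in Wronskian form. -/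
lemma eval_realHermite_wronskian (x y : ℝ) (k : ℕ) :
    (derivative (realHermite k)).eval x * (realHermite k).eval y -
      (realHermite k).eval x * (derivative (realHermite k)).eval y =
    -(x - y) * (k ! * ∑ j ∈ Finset.range k, mehlerTerm x y j) := by
  induction k with
  | zero => simp [realHermite_zero]
  | succ k ih =>
    have h := factorial_mul_mehlerTerm x y k
    rw [derivative_realHermite_succ, realHermite_succ, Finset.sum_range_succ, Nat.factorial_succ]
    simp only [eval_smul, eval_sub, eval_mul, eval_X, smul_eq_mul]
    push_cast
    linear_combination (k + 1 : ℝ) * ih + (k + 1 : ℝ) * (x - y) * h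

end Hermite

/-! ### The weights and the recurrence of their convolutions. -/

section Weights

/-- The Taylor coefficients at `0` of `exp (β x ^ 2) / (1 - x) ^ 2`. -/
noncomputable def expTaylorWeight (β : ℝ) : ℕ → ℝ
  | 0 => 1
  | 1 => 2
  | 2 => 3 + β
  | j + 3 => ((j + 4) * expTaylorWeight β (j + 2) + 2 * β * expTaylorWeight β (j + 1) -
      2 * β * expTaylorWeight β j) / (j + 3)

/-- For `W = exp (β z²) / (1 - z)²` this is `W' = 2 W / (1 - z) + 2 β z W` read on coefficients,
since dividing by `1 - z` forms partial sums. -/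
lemma expTaylorWeight_succ_succ (β : ℝ) (j : ℕ) :
    (j + 2 : ℝ) * expTaylorWeight β (j + 2) =
      2 * ∑ i ∈ Finset.range (j + 2), expTaylorWeight β i + 2 * β * expTaylorWeight β j := by
  induction j with
  | zero => simp [expTaylorWeight, Finset.sum_range_succ]; ring
  | succ j ih =>
    have h : (j + 3 : ℝ) * expTaylorWeight β (j + 3) = (j + 4) * expTaylorWeight β (j + 2) +
        2 * β * expTaylorWeight β (j + 1) - 2 * β * expTaylorWeight β j := by
      rw [expTaylorWeight]
      field_simp
    rw [Finset.sum_range_succ]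
    push_cast
    linear_combination h + ih

lemma sum_mul_sum_range_succ (a q : ℕ → ℝ) (N : ℕ) :
    ∑ k ∈ Finset.range (N + 1), a (N - k) * ∑ j ∈ Finset.range (k + 1), q j =
      ∑ j ∈ Finset.range (N + 1), (∑ i ∈ Finset.range (N - j + 1), a i) * q j := by
  simp only [Finset.mul_sum, Finset.range_eq_Ico]
  rw [← Finset.sum_Ico_Ico_comm]
  refine Finset.sum_congr rfl fun j hj => ?_
  have hj : j < N + 1 := (Finset.mem_Ico.1 hj).2
  rw [Finset.sum_Ico_eq_sum_range, ← Finset.range_eq_Ico, ← Finset.sum_mul,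
    show N + 1 - j = N - j + 1 by omega, ← Finset.sum_range_reflect]
  refine congrArg (· * q j) (Finset.sum_congr rfl fun i hi => congrArg a ?_)
  have := Finset.mem_range.1 hi
  omega

/-- `∑ k ≤ N, a_{N-k} q_k` for the weights `a`. -/
noncomputable def weightedSum (β : ℝ) (q : ℕ → ℝ) (N : ℕ) : ℝ :=
  ∑ k ∈ Finset.range (N + 1), expTaylorWeight β (N - k) * q k

/-- The product rule on coefficients, for arbitrary `q`: write `N + 1 = k + (N + 1 - k)` in each
term. The first part falls on `q` (`h1`), and the second falls on the weights (`h2`) and is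
rewritten by their recurrence. -/
lemma weightedSum_succ (β : ℝ) (q : ℕ → ℝ) (N : ℕ) :
    (N + 1 : ℝ) * weightedSum β q (N + 1) =
      ∑ k ∈ Finset.range (N + 1), expTaylorWeight β (N - k) *
        (2 * ∑ j ∈ Finset.range (k + 1), q j + (k + 1) * q (k + 1)) +
      2 * β * (if N = 0 then 0 else weightedSum β q (N - 1)) := by
  have h1 : ∑ k ∈ Finset.range (N + 1), expTaylorWeight β (N - k) * ((k + 1 : ℝ) * q (k + 1)) =
      ∑ k ∈ Finset.range (N + 2), expTaylorWeight β (N + 1 - k) * (k * q k) := by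
    rw [Finset.sum_range_succ' _ (N + 1)]
    simp
  have h2 : 2 * ∑ k ∈ Finset.range (N + 1), expTaylorWeight β (N - k) *
        ∑ j ∈ Finset.range (k + 1), q j +
      2 * β * (if N = 0 then 0 else weightedSum β q (N - 1)) =
      ∑ k ∈ Finset.range (N + 2), ((N + 1 : ℝ) - k) * expTaylorWeight β (N + 1 - k) * q k := by
    rw [sum_mul_sum_range_succ, Finset.sum_range_succ _ (N + 1)]
    rcases N with _ | N
    · simp [expTaylorWeight]
    · simp only [Nat.add_eq_zero_iff, one_ne_zero, and_false, if_false, Nat.add_sub_cancel,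
        weightedSum]
      rw [Finset.sum_range_succ, Finset.sum_range_succ _ (N + 1)]
      -- The recurrence of the weights starts at index `2`. The two last terms are apart: one uses
      -- that the weight of index `1` is twice that of index `0`, the other has factor zero.
      have h3 : ∀ k ∈ Finset.range (N + 1),
          ((N + 1 : ℕ) + 1 - k : ℝ) * expTaylorWeight β (N + 1 + 1 - k) * q k =
          2 * ((∑ i ∈ Finset.range (N + 1 - k + 1), expTaylorWeight β i) * q k) +
          2 * β * (expTaylorWeight β (N - k) * q k) := by
        intro k hk
        have hk : k ≤ N := Nat.lt_succ_iff.1 (Finset.mem_range.1 hk)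
        obtain ⟨m, rfl⟩ := Nat.exists_eq_add_of_le hk
        have h := expTaylorWeight_succ_succ β m
        rw [show k + m + 1 + 1 - k = m + 2 by omega, show k + m + 1 - k + 1 = m + 2 by omega,
          show k + m - k = m by omega]
        push_cast
        linear_combination q k * h
      rw [Finset.sum_congr rfl h3, Finset.sum_add_distrib, ← Finset.mul_sum, ← Finset.mul_sum]
      simp [expTaylorWeight]
      ring
  have h4 : ∑ k ∈ Finset.range (N + 1), expTaylorWeight β (N - k) *
        (2 * ∑ j ∈ Finset.range (k + 1), q j + (k + 1) * q (k + 1)) =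
      2 * ∑ k ∈ Finset.range (N + 1), expTaylorWeight β (N - k) *
        ∑ j ∈ Finset.range (k + 1), q j +
      ∑ k ∈ Finset.range (N + 1), expTaylorWeight β (N - k) * ((k + 1 : ℝ) * q (k + 1)) := by
    rw [Finset.mul_sum, ← Finset.sum_add_distrib]
    exact Finset.sum_congr rfl fun k _ => by ring
  rw [h4, h1, add_right_comm, h2, ← Finset.sum_add_distrib, weightedSum, Finset.mul_sum]
  exact Finset.sum_congr rfl fun k _ => by ring

end Weights

/-! ### The exact formula for the correlation function. -/

namespace Matrix

open Polynomial

/-- The polynomial `x ↦ det (M - x)`. -/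
noncomputable def detSubX {n : ℕ} (M : Matrix (Fin n) (Fin n) ℝ) : ℝ[X] :=
  (M.map C - (X : ℝ[X]) • (1 : Matrix (Fin n) (Fin n) ℝ[X])).det

lemma eval_detSubX {n : ℕ} (M : Matrix (Fin n) (Fin n) ℝ) (x : ℝ) :
    M.detSubX.eval x = (M - x • (1 : Matrix (Fin n) (Fin n) ℝ)).det := by
  rw [detSubX, ← coe_evalRingHom, RingHom.map_det]
  congr 1
  ext i j
  by_cases h : i = j <;> simp [h]

lemma natDegree_detSubX_le {n : ℕ} (M : Matrix (Fin n) (Fin n) ℝ) : M.detSubX.natDegree ≤ n := by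
  have h := natDegree_det_X_add_C_le (-1 : Matrix (Fin n) (Fin n) ℝ) M
  rw [Fintype.card_fin] at h
  have h' : M.map C - (X : ℝ[X]) • (1 : Matrix (Fin n) (Fin n) ℝ[X]) =
      (X : ℝ[X]) • (-1 : Matrix (Fin n) (Fin n) ℝ).map C + M.map C := by
    ext1 i j
    by_cases h : i = j <;> simp [h, sub_eq_neg_add]
  rwa [detSubX, h']

end Matrix

namespace IsWignerArray

variable {Ω : Type*} [MeasurableSpace Ω] {P : Measure Ω} [IsProbabilityMeasure P]
  {Q : Measure ℝ} {X : ℕ → ℕ → Ω → ℝ}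

lemma hasMean_det_mul_det (hX : IsWignerArray P Q X)
    (hmean : ∫ x, x ∂Q = 0) (hvar : ∫ x, x ^ 2 ∂Q = 1)
    (hfourth : Integrable (fun x : ℝ => x ^ 4) Q) {b : ℝ} (hb : b = ∫ x, x ^ 4 ∂Q)
    {n : ℕ} {e : Fin n → ℕ} (he : Function.Injective e) (x y : ℝ) :
    HasMean P (fun ω => (wignerSubmatrix X e ω - x • (1 : Matrix (Fin n) (Fin n) ℝ)).det *
        (wignerSubmatrix X e ω - y • (1 : Matrix (Fin n) (Fin n) ℝ)).det)
      ((n ! : ℝ) * weightedSum ((b - 3) / 2) (mehlerTerm x y) n) := by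
  induction n using Nat.strong_induction_on generalizing x y with
  | _ n ih =>
  rcases n with _ | n
  · refine ⟨by simp, ?_⟩
    simp [weightedSum, expTaylorWeight, mehlerTerm, realHermite_zero]
  have hint (x y : ℝ) := hX.hasMean_det_mul_det_succ hmean hvar hfourth hb he x y
  refine ⟨(hint x y).1, ?_⟩
  have he' : Function.Injective (e ∘ Fin.succ) := he.comp (Fin.succ_injective n)
  let p (ω : Ω) := (wignerSubmatrix X (e ∘ Fin.succ) ω).detSubX
  have hpdeg (ω : Ω) : (p ω).natDegree ≤ n := Matrix.natDegree_detSubX_le _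
  have hp (ω : Ω) (x : ℝ) : (wignerSubmatrix X (e ∘ Fin.succ) ω -
      x • (1 : Matrix (Fin n) (Fin n) ℝ)).det = (p ω).eval x := (Matrix.eval_detSubX _ _).symm
  have hp' (ω : Ω) (x : ℝ) : (wignerSubmatrix X (e ∘ Fin.succ) ω -
      x • (1 : Matrix (Fin n) (Fin n) ℝ)).adjugate.trace = -(p ω).derivative.eval x := by
    rw [eq_neg_iff_add_eq_zero, add_comm, ← eq_neg_iff_add_eq_zero]
    exact Matrix.derivative_det_map_C_sub_X _ _
  let w (k : ℕ) : ℝ := (n ! : ℝ) * expTaylorWeight ((b - 3) / 2) (n - k) / (k ! : ℝ)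
  have hpp (x y : ℝ) : HasMean P (fun ω => (p ω).eval x * (p ω).eval y)
      (∑ k ∈ Finset.range (n + 1), w k * ((realHermite k).eval x * (realHermite k).eval y)) := by
    simp only [← hp]
    convert ih n (Nat.lt_succ_self n) he' x y using 1
    rw [weightedSum, Finset.mul_sum]
    refine Finset.sum_congr rfl fun k _ => ?_
    rw [mehlerTerm]
    ring
  have hbil := hasMean_linearMap_mul_linearMap hpdeg
    (fun k hk => (natDegree_realHermite_le k).trans (Nat.lt_succ_iff.1 (Finset.mem_range.1 hk))) hpp
  -- Diagonal adjugate entries are characteristic polynomials of Wigner minors of size `n - 1`, so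
  -- the induction hypothesis applies. For `n = 0`, where `n - 1` is truncated, there is no index
  -- `i`.
  have hmin (x y : ℝ) (i : Fin n) : HasMean P (fun ω =>
      (wignerSubmatrix X (e ∘ Fin.succ) ω - x • (1 : Matrix (Fin n) (Fin n) ℝ)).adjugate i i *
      (wignerSubmatrix X (e ∘ Fin.succ) ω - y • (1 : Matrix (Fin n) (Fin n) ℝ)).adjugate i i)
      ((n - 1)! * weightedSum ((b - 3) / 2) (mehlerTerm x y) (n - 1)) := by
    rcases n with _ | n
    · exact i.elim0
    · have h (ω : Ω) (x : ℝ) : (wignerSubmatrix X (e ∘ Fin.succ) ω -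
          x • (1 : Matrix (Fin (n + 1)) (Fin (n + 1)) ℝ)).adjugate i i =
          (wignerSubmatrix X (e ∘ Fin.succ ∘ i.succAbove) ω -
            x • (1 : Matrix (Fin n) (Fin n) ℝ)).det := by
        rw [Matrix.adjugate_fin_succ_eq_det_submatrix, Even.neg_one_pow ⟨_, rfl⟩, one_mul]
        congr 1
        ext k l
        simp [wignerSubmatrix, Matrix.one_apply]
      simp only [h]
      exact ih n (by omega) (he'.comp i.succAbove_right_injective) x y
  -- Off the diagonal the trace of the product of adjugates may be divided by `x - y`.
  have hgen (x y : ℝ) (hxy : x ≠ y) :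
      ∫ ω, (wignerSubmatrix X e ω - x • (1 : Matrix (Fin (n + 1)) (Fin (n + 1)) ℝ)).det *
        (wignerSubmatrix X e ω - y • (1 : Matrix (Fin (n + 1)) (Fin (n + 1)) ℝ)).det ∂P =
      (n + 1)! * weightedSum ((b - 3) / 2) (mehlerTerm x y) (n + 1) := by
    have hxy' : x - y ≠ 0 := sub_ne_zero.2 hxy
    let D : Polynomial ℝ →ₗ[ℝ] Polynomial ℝ := Polynomial.derivative
    have h2 := hbil (Polynomial.leval x) (Polynomial.leval y ∘ₗ D)
    have h3 := hbil (Polynomial.leval x ∘ₗ D) (Polynomial.leval y)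
    have h4 := hbil (Polynomial.leval x ∘ₗ D) (Polynomial.leval y ∘ₗ D)
    have hall := (((((hpp x y).const_mul (2 + x * y)).sub (h2.const_mul x)).sub
      (h3.const_mul y)).add h4).add (((h2.sub h3).const_mul (2 / (x - y))).add
      ((HasMean.sum (s := .univ) fun i _ => hmin x y i).const_mul (b - 3)))
    rw [(hint x y).2]
    refine Eq.trans (integral_congr_ae (ae_of_all _ fun ω => ?_)) (hall.2.trans ?_)
    · have htr := Matrix.sub_mul_trace_adjugate_mul_adjugate
        (wignerSubmatrix X (e ∘ Fin.succ) ω) x y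
      simp only [hp, hp'] at htr ⊢
      change _ = (2 + x * y) * ((p ω).eval x * (p ω).eval y) -
        x * ((p ω).eval x * (p ω).derivative.eval y) -
        y * ((p ω).derivative.eval x * (p ω).eval y) +
        (p ω).derivative.eval x * (p ω).derivative.eval y +
        (2 / (x - y) * ((p ω).eval x * (p ω).derivative.eval y -
          (p ω).derivative.eval x * (p ω).eval y) + (b - 3) * _)
      rw [mul_comm, ← eq_div_iff hxy'] at htr
      rw [htr]
      ring
    · have hw (k : ℕ) : w k * (k ! : ℝ) = (n ! : ℝ) * expTaylorWeight ((b - 3) / 2) (n - k) := by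
        have : (k ! : ℝ) ≠ 0 := by positivity
        simp only [w]
        field_simp
      -- The terms `xy`, `x`, `y` and the product of derivatives factor as `(x He_k - He_k')(y He_k
      -- - He_k') = He_{k+1}(x) He_{k+1}(y)`. The Wronskian gives the partial sum over `j < k`, and
      -- the constant `2` supplies its term `j = k`.
      have hk : ∀ k ∈ Finset.range (n + 1), (n ! : ℝ) * (expTaylorWeight ((b - 3) / 2) (n - k) *
          (2 * ∑ j ∈ Finset.range (k + 1), mehlerTerm x y j + (k + 1) * mehlerTerm x y (k + 1))) =
          (2 + x * y) * (w k * ((realHermite k).eval x * (realHermite k).eval y)) -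
          x * (w k * ((realHermite k).eval x * (realHermite k).derivative.eval y)) -
          y * (w k * ((realHermite k).derivative.eval x * (realHermite k).eval y)) +
          w k * ((realHermite k).derivative.eval x * (realHermite k).derivative.eval y) +
          2 / (x - y) * (w k * ((realHermite k).eval x * (realHermite k).derivative.eval y) -
            w k * ((realHermite k).derivative.eval x * (realHermite k).eval y)) := by
        intro k _
        have hwr := eval_realHermite_wronskian x y k
        have hq := factorial_mul_mehlerTerm x y k
        have hq' := factorial_mul_mehlerTerm x y (k + 1)
        have hwr' : 2 / (x - y) * (w k * ((realHermite k).eval x *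
            (realHermite k).derivative.eval y) -
            w k * ((realHermite k).derivative.eval x * (realHermite k).eval y)) =
            2 * (w k * (k ! * ∑ j ∈ Finset.range k, mehlerTerm x y j)) := by
          rw [div_mul_eq_mul_div, div_eq_iff hxy']
          linear_combination -2 * w k * hwr
        rw [hwr', Finset.sum_range_succ, ← mul_assoc, ← hw]
        rw [Nat.factorial_succ, realHermite_succ] at hq'
        simp only [Polynomial.eval_sub, Polynomial.eval_mul, Polynomial.eval_X] at hq'
        push_cast at hq'
        linear_combination w k * hq' + 2 * w k * hq
      have hsum := Finset.sum_congr rfl hk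
      simp only [Finset.sum_add_distrib, Finset.sum_sub_distrib, ← Finset.mul_sum] at hsum
      have hrec := weightedSum_succ ((b - 3) / 2) (mehlerTerm x y) n
      -- The `n` equal diagonal terms turn `(n - 1)!` into `n !`; this fixes `β = (b - 3) / 2`.
      have hlast : (b - 3) * ∑ _i : Fin n, (((n - 1)! : ℝ) *
          weightedSum ((b - 3) / 2) (mehlerTerm x y) (n - 1)) = n ! * (2 * ((b - 3) / 2) *
          (if n = 0 then 0 else weightedSum ((b - 3) / 2) (mehlerTerm x y) (n - 1))) := by
        rcases n with _ | n
        · simp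
        · simp [Nat.factorial_succ]
          ring
      rw [hlast, Nat.factorial_succ]
      push_cast
      refine Eq.trans ?_ ((mul_comm (n + 1 : ℝ) (n ! : ℝ)) ▸ (mul_assoc (n ! : ℝ) (n + 1 : ℝ)
        (weightedSum ((b - 3) / 2) (mehlerTerm x y) (n + 1))).symm)
      rw [hrec, mul_add, hsum]
      exact (add_assoc _ _ _).symm
  have hfun : (fun x => ∫ ω,
      (wignerSubmatrix X e ω - x • (1 : Matrix (Fin (n + 1)) (Fin (n + 1)) ℝ)).det *
        (wignerSubmatrix X e ω - y • (1 : Matrix (Fin (n + 1)) (Fin (n + 1)) ℝ)).det ∂P) =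
      fun x => (n + 1)! * weightedSum ((b - 3) / 2) (mehlerTerm x y) (n + 1) := by
    -- Both sides are continuous in `x`, so the case `x = y` follows by density.
    refine Continuous.ext_on (dense_compl_singleton y) ?_ ?_ fun x hx => hgen x y hx
    · simp only [← Matrix.eval_detSubX]
      refine continuous_integral_eval_mul (fun ω => Matrix.natDegree_detSubX_le _) fun x => ?_
      simp only [Matrix.eval_detSubX]
      exact (hint x y).1
    · unfold weightedSum mehlerTerm
      fun_prop
  exact congrFun hfun x

end IsWignerArray

/-! ### Formal Taylor series and differential equations. -/

section TaylorSeries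

/-- The formal Taylor series at `0` of a function of a complex variable. -/
noncomputable def formalTaylor (F : ℂ → ℂ) : PowerSeries ℂ :=
  PowerSeries.mk fun n => iteratedDeriv n F 0 / n !

lemma formalTaylor_mul {F G : ℂ → ℂ} (hF : AnalyticAt ℂ F 0) (hG : AnalyticAt ℂ G 0) :
    formalTaylor (fun z => F z * G z) = formalTaylor F * formalTaylor G := by
  ext n
  simp only [formalTaylor, PowerSeries.coeff_mk, PowerSeries.coeff_mul]
  rw [iteratedDeriv_fun_mul hF.contDiffAt hG.contDiffAt, Finset.sum_div,
    Finset.Nat.sum_antidiagonal_eq_sum_range_succ_mk]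
  refine Finset.sum_congr rfl fun i hi => ?_
  have hi : i ≤ n := Nat.lt_succ_iff.1 (Finset.mem_range.1 hi)
  rw [Nat.cast_choose ℂ hi]
  have h1 : (n ! : ℂ) ≠ 0 := by exact_mod_cast n.factorial_ne_zero
  field_simp

lemma formalTaylor_add {F G : ℂ → ℂ} (hF : AnalyticAt ℂ F 0) (hG : AnalyticAt ℂ G 0) :
    formalTaylor (fun z => F z + G z) = formalTaylor F + formalTaylor G := by
  ext n
  simp only [formalTaylor, PowerSeries.coeff_mk, map_add]
  rw [iteratedDeriv_fun_add hF.contDiffAt hG.contDiffAt, add_div]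

lemma formalTaylor_deriv (F : ℂ → ℂ) :
    formalTaylor (deriv F) = PowerSeries.derivative ℂ (formalTaylor F) := by
  ext n
  simp only [formalTaylor, PowerSeries.coeff_mk, PowerSeries.coeff_derivative,
    iteratedDeriv_succ', Nat.factorial_succ]
  have h1 : (n ! : ℂ) ≠ 0 := by exact_mod_cast n.factorial_ne_zero
  have h2 : (n + 1 : ℂ) ≠ 0 := by exact_mod_cast n.succ_ne_zero
  push_cast
  field_simp

lemma formalTaylor_congr {F G : ℂ → ℂ} (h : F =ᶠ[𝓝 0] G) : formalTaylor F = formalTaylor G := by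
  ext n
  simp only [formalTaylor, PowerSeries.coeff_mk, h.iteratedDeriv_eq]

lemma formalTaylor_polynomial (p : Polynomial ℂ) : formalTaylor (fun z => p.eval z) = p := by
  have hmon (n : ℕ) (a : ℂ) : formalTaylor (fun z => a * z ^ n) =
      (Polynomial.monomial n a : Polynomial ℂ) := by
    ext k
    simp only [formalTaylor, PowerSeries.coeff_mk, Polynomial.coeff_coe, Polynomial.coeff_monomial]
    rw [iteratedDeriv_const_mul_field, iteratedDeriv_fun_pow_zero]
    split_ifs with h1 h2 h2
    · have : (n ! : ℂ) ≠ 0 := by exact_mod_cast n.factorial_ne_zero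
      subst h1
      field_simp
    · omega
    · omega
    · simp
  induction p using Polynomial.induction_on' with
  | add p q hp hq =>
    simp only [Polynomial.eval_add, Polynomial.coe_add]
    rw [formalTaylor_add (p.differentiable.analyticAt 0) (q.differentiable.analyticAt 0), hp, hq]
  | monomial n a =>
    simp only [Polynomial.eval_monomial]
    exact hmon n a

lemma coeff_zero_formalTaylor (F : ℂ → ℂ) : PowerSeries.coeff 0 (formalTaylor F) = F 0 := by
  simp [formalTaylor]

open Polynomial in
/-- A first-order linear differential equation for `F` transfers to its Taylor series. -/
lemma formalTaylor_ode {F : ℂ → ℂ} (hF : AnalyticAt ℂ F 0) (p q : ℂ[X])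
    (h : ∀ᶠ z in 𝓝 0, p.eval z * deriv F z = q.eval z * F z) :
    (p : PowerSeries ℂ) * PowerSeries.derivative ℂ (formalTaylor F) = q * formalTaylor F := by
  have h' := formalTaylor_congr (F := fun z => p.eval z * deriv F z) h
  rwa [formalTaylor_mul (p.differentiable.analyticAt 0) hF.deriv,
    formalTaylor_mul (q.differentiable.analyticAt 0) hF,
    formalTaylor_deriv, formalTaylor_polynomial, formalTaylor_polynomial] at h'

end TaylorSeries

lemma eval_realHermite_succ_succ (x : ℝ) (n : ℕ) :
    (realHermite (n + 2)).eval x =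
      x * (realHermite (n + 1)).eval x - (n + 1) * (realHermite n).eval x := by
  rw [realHermite_succ (n + 1), derivative_realHermite_succ]
  simp

/-! ### Generating functions of the weights and of Mehler's series. -/

section GeneratingFunctions

open Complex

/-- The generating function `exp (β z ^ 2) / (1 - z) ^ 2` of the weights. -/
noncomputable def weightGen (β : ℝ) (z : ℂ) : ℂ := exp (β * z ^ 2) * ((1 - z) ^ 2)⁻¹

/-- Mehler's kernel as a function of its parameter `z`. -/
noncomputable def mehlerKernel (x y : ℝ) (z : ℂ) : ℂ :=
  exp ((x * y * z - (x ^ 2 + y ^ 2) / 2 * z ^ 2) / (1 - z ^ 2)) * (1 - z ^ 2) ^ (-(1 / 2) : ℂ)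

lemma one_sub_ne_zero_of_norm_lt_one {z : ℂ} (hz : ‖z‖ < 1) : 1 - z ≠ 0 := by
  intro h
  rw [← sub_eq_zero.1 h] at hz
  simp at hz

lemma one_sub_sq_mem_slitPlane {z : ℂ} (hz : ‖z‖ < 1) : 1 - z ^ 2 ∈ slitPlane := by
  left
  have h1 : (z ^ 2).re ≤ ‖z ^ 2‖ := re_le_norm _
  rw [norm_pow] at h1
  have h2 : ‖z‖ ^ 2 < 1 := by nlinarith [norm_nonneg z]
  simp only [sub_re, one_re]
  linarith

lemma hasDerivAt_weightGen (β : ℝ) {z : ℂ} (hz : ‖z‖ < 1) :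
    HasDerivAt (weightGen β) ((2 * β * z + 2 / (1 - z)) * weightGen β z) z := by
  have h0 := one_sub_ne_zero_of_norm_lt_one hz
  have h1 : HasDerivAt (fun z : ℂ => exp (β * z ^ 2)) (exp (β * z ^ 2) * (β * (2 * z))) z := by
    have := ((hasDerivAt_id z).pow 2).const_mul (β : ℂ)
    simpa using this.cexp
  have h2 : HasDerivAt (fun z : ℂ => ((1 - z) ^ 2)⁻¹)
      (-(2 * (1 - z) * (-1)) / ((1 - z) ^ 2) ^ 2) z := by
    have := (((hasDerivAt_id' z).const_sub 1).fun_pow 2).fun_inv (pow_ne_zero 2 h0)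
    simpa using this
  refine HasDerivAt.congr_deriv (f := weightGen β) (h1.fun_mul h2) ?_
  simp only [weightGen]
  field_simp

lemma hasDerivAt_mehlerKernel (x y : ℝ) {z : ℂ} (hz : ‖z‖ < 1) :
    HasDerivAt (mehlerKernel x y)
      ((x * y * (1 + z ^ 2) - (x ^ 2 + y ^ 2) * z + z - z ^ 3) / (1 - z ^ 2) ^ 2 *
        mehlerKernel x y z) z := by
  have hs := one_sub_sq_mem_slitPlane hz
  have h0 : 1 - z ^ 2 ≠ 0 := slitPlane_ne_zero hs
  have h1 : HasDerivAt (fun z : ℂ => 1 - z ^ 2) (-(2 * z)) z := by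
    simpa using ((hasDerivAt_id z).pow 2).const_sub 1
  have h2 : HasDerivAt (fun z : ℂ => x * y * z - (x ^ 2 + y ^ 2) / 2 * z ^ 2)
      (x * y - (x ^ 2 + y ^ 2) / 2 * (2 * z)) z := by
    simpa using ((hasDerivAt_id' z).const_mul (x * y : ℂ)).fun_sub
      (((hasDerivAt_id' z).fun_pow 2).const_mul ((x ^ 2 + y ^ 2) / 2 : ℂ))
  have h3 := (h2.fun_div h1 h0).cexp
  have h4 := h1.cpow_const (c := (-(1 / 2) : ℂ)) hs
  refine HasDerivAt.congr_deriv (f := mehlerKernel x y) (h3.fun_mul h4) ?_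
  simp only [mehlerKernel]
  rw [cpow_sub _ _ h0, cpow_one]
  field_simp
  ring

lemma analyticAt_of_hasDerivAt_unit_ball {F F' : ℂ → ℂ}
    (h : ∀ z : ℂ, ‖z‖ < 1 → HasDerivAt F (F' z) z) : AnalyticAt ℂ F 0 := by
  have hd : DifferentiableOn ℂ F (Metric.ball 0 1) := fun z hz =>
    (h z (by simpa using hz)).differentiableAt.differentiableWithinAt
  exact hd.analyticAt (Metric.ball_mem_nhds 0 one_pos)

lemma eventually_norm_lt_one : ∀ᶠ z : ℂ in 𝓝 0, ‖z‖ < 1 := by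
  filter_upwards [Metric.ball_mem_nhds (0 : ℂ) one_pos] with z hz
  simpa using hz

/-- The equation `(1 - z) W' = (2 + 2 β z - 2 β z²) W` yields on coefficients the recurrence
defining the weights. -/
lemma coeff_formalTaylor_weightGen (β : ℝ) (n : ℕ) :
    PowerSeries.coeff n (formalTaylor (weightGen β)) = expTaylorWeight β n := by
  have hode := formalTaylor_ode (analyticAt_of_hasDerivAt_unit_ball fun z hz =>
      hasDerivAt_weightGen β hz) (1 - Polynomial.X)
    (Polynomial.C (2 * β : ℂ) * Polynomial.X - Polynomial.C (2 * β : ℂ) * Polynomial.X ^ 2 +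
      Polynomial.C 2) (by
      filter_upwards [eventually_norm_lt_one] with z hz
      rw [(hasDerivAt_weightGen β hz).deriv]
      have h0 := one_sub_ne_zero_of_norm_lt_one hz
      simp
      field_simp)
  have h0 := coeff_zero_formalTaylor (weightGen β)
  have hrec (n : ℕ) := congrArg (PowerSeries.coeff n) hode
  have hrec0 := hrec 0
  have hrec1 := hrec 1
  have hrecn (n : ℕ) := hrec (n + 2)
  have hc (g : PowerSeries ℂ) := (PowerSeries.coeff_zero_eq_constantCoeff_apply g).symm
  simp [sub_mul, add_mul, mul_assoc, pow_succ, PowerSeries.coeff_succ_X_mul,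
    PowerSeries.coeff_derivative, weightGen] at h0 hrec0 hrec1 hrecn
  simp only [hc, PowerSeries.coeff_derivative] at h0 hrec0 hrec1 hrecn
  induction n using Nat.strong_induction_on with
  | _ n ih =>
  match n with
  | 0 => simpa [expTaylorWeight] using h0
  | 1 =>
    simp [h0] at hrec0
    simp [hrec0, expTaylorWeight]
  | 2 =>
    simp [h0] at hrec0
    rw [h0, hrec0] at hrec1
    simp only [expTaylorWeight]
    push_cast
    linear_combination hrec1 / 2
  | n + 3 =>
    have h := hrecn n
    rw [show n + 2 + 1 = n + 3 from rfl, show n + 1 + 1 = n + 2 from rfl, ih n (by omega),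
      ih (n + 1) (by omega), ih (n + 2) (by omega)] at h
    have h3 : (n + 3 : ℂ) ≠ 0 := by exact_mod_cast (Nat.succ_ne_zero (n + 2))
    rw [expTaylorWeight]
    push_cast
    rw [eq_div_iff h3]
    linear_combination h

/-- The coefficient form of `(1 - z²)² M' = (x y (1 + z²) - (x² + y²) z + z - z³) M`, the equation
satisfied by Mehler's kernel; it reduces to the three-term recurrence of `He_k`. -/
lemma mehlerTerm_recurrence (x y : ℝ) (n : ℕ) :
    (n + 4) * mehlerTerm x y (n + 4) = 2 * (n + 2) * mehlerTerm x y (n + 2) - n * mehlerTerm x y n +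
      x * y * (mehlerTerm x y (n + 3) + mehlerTerm x y (n + 1)) -
      (x ^ 2 + y ^ 2) * mehlerTerm x y (n + 2) + mehlerTerm x y (n + 2) - mehlerTerm x y n := by
  have hrec (x : ℝ) (n : ℕ) := eval_realHermite_succ_succ x n
  have h3 (x : ℝ) := hrec x (n + 1)
  have h4 (x : ℝ) := hrec x (n + 2)
  have hf : (n ! : ℝ) ≠ 0 := by positivity
  simp only [mehlerTerm, h4, h3, hrec, Nat.factorial_succ, show n + 1 + 2 = n + 3 from rfl,
    show n + 1 + 1 = n + 2 from rfl]
  push_cast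
  field_simp
  ring

lemma coeff_formalTaylor_mehlerKernel (x y : ℝ) (n : ℕ) :
    PowerSeries.coeff n (formalTaylor (mehlerKernel x y)) = mehlerTerm x y n := by
  have hode := formalTaylor_ode (analyticAt_of_hasDerivAt_unit_ball fun z hz =>
      hasDerivAt_mehlerKernel x y hz) (1 - Polynomial.C 2 * Polynomial.X ^ 2 + Polynomial.X ^ 4)
    (Polynomial.C (x * y : ℂ) + Polynomial.C (1 - x ^ 2 - y ^ 2 : ℂ) * Polynomial.X +
      Polynomial.C (x * y : ℂ) * Polynomial.X ^ 2 - Polynomial.X ^ 3) (by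
      filter_upwards [eventually_norm_lt_one] with z hz
      rw [(hasDerivAt_mehlerKernel x y hz).deriv]
      have h0 := slitPlane_ne_zero (one_sub_sq_mem_slitPlane hz)
      simp
      field_simp
      ring)
  have h0 := coeff_zero_formalTaylor (mehlerKernel x y)
  have hrec (n : ℕ) := congrArg (PowerSeries.coeff n) hode
  have hrec0 := hrec 0
  have hrec1 := hrec 1
  have hrec2 := hrec 2
  have hrecn (n : ℕ) := hrec (n + 3)
  have hc (g : PowerSeries ℂ) := (PowerSeries.coeff_zero_eq_constantCoeff_apply g).symm
  have hX (g : PowerSeries ℂ) (n : ℕ) :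
      PowerSeries.coeff n (PowerSeries.X * PowerSeries.derivative ℂ g) =
        n * PowerSeries.coeff n g := by
    rcases n with _ | n
    · simp
    · rw [PowerSeries.coeff_succ_X_mul, PowerSeries.coeff_derivative, mul_comm]
      push_cast
      rfl
  simp [sub_mul, add_mul, mul_assoc, pow_succ, PowerSeries.coeff_succ_X_mul,
    PowerSeries.coeff_derivative, mehlerKernel] at h0 hrec0 hrec1 hrec2 hrecn
  simp only [hc, PowerSeries.coeff_derivative, hX] at h0 hrec0 hrec1 hrec2 hrecn
  have e0 (x : ℝ) : (realHermite 0).eval x = 1 := by simp [realHermite_zero]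
  have e1 (x : ℝ) : (realHermite 1).eval x = x := by simp [realHermite_succ, realHermite_zero]
  have e2 (x : ℝ) := eval_realHermite_succ_succ x 0
  have e3 (x : ℝ) := eval_realHermite_succ_succ x 1
  have hm0 : mehlerTerm x y 0 = 1 := by simp [mehlerTerm, e0]
  have hm1 : mehlerTerm x y 1 = x * y := by simp [mehlerTerm, e1]
  have hm2 : mehlerTerm x y 2 = (x ^ 2 - 1) * (y ^ 2 - 1) / 2 := by
    simp [mehlerTerm, e2, e1, e0, Nat.factorial]
    ring
  have hm3 : mehlerTerm x y 3 = (x ^ 3 - 3 * x) * (y ^ 3 - 3 * y) / 6 := by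
    simp [mehlerTerm, e3, e2, e1, e0, Nat.factorial]
    ring
  have g1 : PowerSeries.coeff 1 (formalTaylor (mehlerKernel x y)) = x * y := by
    simpa [h0] using hrec0
  have g2 : PowerSeries.coeff 2 (formalTaylor (mehlerKernel x y)) =
      (x ^ 2 - 1) * (y ^ 2 - 1) / 2 := by
    rw [h0, g1] at hrec1
    linear_combination hrec1 / 2
  induction n using Nat.strong_induction_on with
  | _ n ih =>
  match n with
  | 0 => rw [h0, hm0, ofReal_one]
  | 1 => rw [g1, hm1, ofReal_mul]
  | 2 => rw [g2, hm2]; push_cast; rfl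
  | 3 =>
    rw [h0, g1, g2] at hrec2
    rw [hm3]
    push_cast
    linear_combination hrec2 / 3
  | n + 4 =>
    have h := hrecn n
    have h' := congrArg (fun r : ℝ => (r : ℂ)) (mehlerTerm_recurrence x y n)
    push_cast at h'
    rw [show n + 3 + 1 = n + 4 from rfl, show n + 1 + 1 = n + 2 from rfl, ih n (by omega),
      ih (n + 1) (by omega), ih (n + 2) (by omega), ih (n + 3) (by omega)] at h
    have h4 : (n + 4 : ℂ) ≠ 0 := by exact_mod_cast (Nat.succ_ne_zero (n + 3))
    refine mul_left_cancel₀ h4 ?_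
    linear_combination h - h'

end GeneratingFunctions

/-! ### Cauchy's formula on the rescaled circle. -/

open Complex in
-- On the circle of radius `exp (-1 / n)` with angle `t / n` one has `z = exp (-(1 - i t) / n)`, so
-- `z ^ (-n)` is exactly `exp (1 - i t)`.
lemma iteratedDeriv_div_factorial_eq_integral {F : ℂ → ℂ}
    (hF : ∀ z : ℂ, ‖z‖ < 1 → DifferentiableAt ℂ F z) {n : ℕ} (hn : n ≠ 0) :
    iteratedDeriv n F 0 / n ! = (2 * Real.pi : ℂ)⁻¹ * ∫ t in -(Real.pi * n)..Real.pi * n,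
      (n : ℂ)⁻¹ * (exp (1 - t * I) * F (exp (-(1 - t * I) / n))) := by
  have hn0 : (n : ℝ) ≠ 0 := by exact_mod_cast hn
  have hnc : (n : ℂ) ≠ 0 := by exact_mod_cast hn
  have hnpos : (0 : ℝ) < n := by positivity
  set r : ℝ := Real.exp (-(1 / n)) with hr
  have hr0 : 0 < r := Real.exp_pos _
  have hr1 : r < 1 := Real.exp_lt_one_iff.2 (by simpa using Nat.pos_of_ne_zero hn)
  have hd : DifferentiableOn ℂ F (Metric.closedBall 0 r) := fun z hz =>
    (hF z ((by simpa using hz : ‖z‖ ≤ r).trans_lt hr1)).differentiableWithinAt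
  have hC := hd.circleIntegral_one_div_sub_center_pow_smul hr0 n
  -- Periodicity moves the angle to `[-π, π]`, which puts the critical point `z = 1` in the middle.
  have hper : Function.Periodic (fun θ : ℝ => (circleMap 0 r θ ^ n)⁻¹ * F (circleMap 0 r θ))
      (2 * Real.pi) := fun θ => by simp only [periodic_circleMap 0 r θ]
  have h1 : (∮ z in C(0, r), (1 / (z - 0) ^ (n + 1)) • F z) =
      I * ∫ θ in (-Real.pi)..Real.pi, (circleMap 0 r θ ^ n)⁻¹ * F (circleMap 0 r θ) := by
    have hp := hper.intervalIntegral_add_eq 0 (-Real.pi)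
    rw [zero_add, show -Real.pi + 2 * Real.pi = Real.pi by ring] at hp
    rw [← hp, circleIntegral, ← intervalIntegral.integral_const_mul]
    refine intervalIntegral.integral_congr fun θ _ => ?_
    have h0 : circleMap 0 r θ ≠ 0 := circleMap_ne_center hr0.ne'
    simp only [deriv_circleMap, sub_zero, smul_eq_mul, pow_succ]
    field_simp
  have h2 : (∫ θ in (-Real.pi)..Real.pi, (circleMap 0 r θ ^ n)⁻¹ * F (circleMap 0 r θ)) =
      ∫ t in -(Real.pi * n)..Real.pi * n,
        (n : ℂ)⁻¹ * (exp (1 - t * I) * F (exp (-(1 - t * I) / n))) := by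
    have h := intervalIntegral.integral_comp_div (a := -(Real.pi * n)) (b := Real.pi * n)
      (fun θ : ℝ => (circleMap 0 r θ ^ n)⁻¹ * F (circleMap 0 r θ)) hn0
    rw [neg_div, mul_div_assoc, div_self hn0, mul_one] at h
    rw [intervalIntegral.integral_const_mul, eq_inv_mul_iff_mul_eq₀ hnc]
    rw [real_smul] at h
    push_cast at h
    rw [← h]
    refine intervalIntegral.integral_congr fun t _ => ?_
    have hx : circleMap 0 r (t / n) = exp (-(1 - t * I) / n) := by
      rw [circleMap, zero_add, hr, ofReal_exp, ← Complex.exp_add]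
      congr 1
      push_cast
      ring
    simp only [hx]
    rw [← Complex.exp_nat_mul, ← Complex.exp_neg]
    congr 2
    field_simp
  rw [h1, h2, smul_eq_mul] at hC
  have hI : I ≠ 0 := I_ne_zero
  have hpi : (Real.pi : ℂ) ≠ 0 := by exact_mod_cast Real.pi_ne_zero
  have hf : (n ! : ℂ) ≠ 0 := by exact_mod_cast n.factorial_ne_zero
  rw [eq_inv_mul_iff_mul_eq₀ (by simp)]
  refine mul_left_cancel₀ hI ?_
  rw [hC]
  field_simp

lemma weightedSum_mehlerTerm_eq_integral (β x y : ℝ) {n : ℕ} (hn : n ≠ 0) :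
    (weightedSum β (mehlerTerm x y) n : ℂ) = (2 * Real.pi : ℂ)⁻¹ *
      ∫ t in -(Real.pi * n)..Real.pi * n, (n : ℂ)⁻¹ * (Complex.exp (1 - t * Complex.I) *
        (weightGen β (Complex.exp (-(1 - t * Complex.I) / n)) *
          mehlerKernel x y (Complex.exp (-(1 - t * Complex.I) / n)))) := by
  rw [← iteratedDeriv_div_factorial_eq_integral (F := fun z => weightGen β z * mehlerKernel x y z)
    (fun z hz => (hasDerivAt_weightGen β hz).differentiableAt.fun_mul
      (hasDerivAt_mehlerKernel x y hz).differentiableAt) hn]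
  have h := congrArg (PowerSeries.coeff n) (formalTaylor_mul
    (analyticAt_of_hasDerivAt_unit_ball fun z hz => hasDerivAt_weightGen β hz)
    (analyticAt_of_hasDerivAt_unit_ball fun z hz => hasDerivAt_mehlerKernel x y hz))
  rw [PowerSeries.coeff_mul] at h
  simp only [coeff_formalTaylor_weightGen, coeff_formalTaylor_mehlerKernel] at h
  rw [formalTaylor, PowerSeries.coeff_mk] at h
  rw [h, weightedSum, ← Finset.Nat.sum_antidiagonal_swap,
    Finset.Nat.sum_antidiagonal_eq_sum_range_succ_mk]
  push_cast
  rfl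

/-! ### Pointwise limit and domination of the contour integrand. -/

section Asymptotics

open Complex

lemma ofReal_mul_cpow {r : ℝ} (hr : 0 < r) {w : ℂ} (hw : w ≠ 0) (s : ℂ) :
    ((r : ℂ) * w) ^ s = (r : ℂ) ^ s * w ^ s := by
  have hr' : (r : ℂ) ≠ 0 := by exact_mod_cast hr.ne'
  rw [cpow_def_of_ne_zero (mul_ne_zero hr' hw), cpow_def_of_ne_zero hr', cpow_def_of_ne_zero hw,
    log_ofReal_mul hr hw, ← Complex.exp_add, ← ofReal_log hr.le]
  ring_nf

/-- This form separates the large quantity `x + y`, of order `√N`, from `x - y`, of order `1 / √N`,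
and attaches the pole at `z = 1` to the latter only. -/
lemma mehlerKernel_eq (x y : ℝ) {z : ℂ} (hz : ‖z‖ < 1) :
    mehlerKernel x y z = exp ((x + y) ^ 2 / 4 * (z / (1 + z)) - (x - y) ^ 2 / 4 * (z / (1 - z))) *
      (1 - z ^ 2) ^ (-(1 / 2) : ℂ) := by
  have h1 := one_sub_ne_zero_of_norm_lt_one hz
  have h2 : 1 + z ≠ 0 := by
    have := one_sub_ne_zero_of_norm_lt_one (z := -z) (by simpa using hz)
    simpa using this
  have h3 : 1 - z ^ 2 = (1 - z) * (1 + z) := by ring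
  have h4 : 1 - z ^ 2 ≠ 0 := by rw [h3]; exact mul_ne_zero h1 h2
  rw [mehlerKernel]
  congr 2
  rw [h3]
  field_simp
  ring

/-- The contour point `exp (-(1 - i t) / N)`. -/
noncomputable def contourPoint (N : ℕ) (t : ℝ) : ℂ := exp (-(1 - t * I) / N)

lemma norm_contourPoint (N : ℕ) (t : ℝ) : ‖contourPoint N t‖ = Real.exp (-(1 / N)) := by
  rw [contourPoint, norm_exp]
  congr 1
  rw [show (-(1 - t * I) / N : ℂ) = ((-(1 / N) : ℝ) : ℂ) + ((t / N : ℝ) : ℂ) * I by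
    push_cast; ring]
  simp only [add_re, ofReal_re, mul_re, I_re, I_im, ofReal_im]
  ring

lemma norm_contourPoint_lt_one {N : ℕ} (hN : N ≠ 0) (t : ℝ) : ‖contourPoint N t‖ < 1 := by
  rw [norm_contourPoint, Real.exp_lt_one_iff]
  simpa using Nat.pos_of_ne_zero hN

/-- The rescaled contour integrand. -/
noncomputable def scaledIntegrand (β ξ m k : ℝ) (N : ℕ) (t : ℝ) : ℂ :=
  exp (β * contourPoint N t ^ 2) * ((N * (1 - contourPoint N t)) ^ 2)⁻¹ *
    (N * (1 - contourPoint N t ^ 2)) ^ (-(1 / 2) : ℂ) *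
    exp (1 - t * I + (N * ξ ^ 2 + ξ * (m + k) + (m + k) ^ 2 / (4 * N)) *
      (contourPoint N t / (1 + contourPoint N t)) - N * ξ ^ 2 / 2 -
      (m - k) ^ 2 / (4 * N) * (contourPoint N t / (1 - contourPoint N t)))

/-- The powers of `N` balance: `N^(-3/2)` and the Jacobian `N^(-1)` against `N²` from `(1 - z)^(-2)`
and `N^(1/2)` from `(1 - z²)^(-1/2)`. -/
lemma scaledIntegrand_eq (β ξ m k : ℝ) {N : ℕ} (hN : N ≠ 0) (t : ℝ) :
    (((N : ℝ) ^ (-(3 / 2) : ℝ) * Real.exp (-(N * ξ ^ 2 / 2)) : ℝ) : ℂ) *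
      ((N : ℂ)⁻¹ * (exp (1 - t * I) * (weightGen β (exp (-(1 - t * I) / N)) *
        mehlerKernel (√N * ξ + m / √N) (√N * ξ + k / √N) (exp (-(1 - t * I) / N))))) =
      scaledIntegrand β ξ m k N t := by
  have hz := norm_contourPoint_lt_one hN t
  rw [← contourPoint, mehlerKernel_eq _ _ hz, weightGen, scaledIntegrand]
  have hNpos : (0 : ℝ) < N := by exact_mod_cast Nat.pos_of_ne_zero hN
  have hNc : (N : ℂ) ≠ 0 := by exact_mod_cast hN
  have h1 := one_sub_ne_zero_of_norm_lt_one hz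
  have h2 := slitPlane_ne_zero (one_sub_sq_mem_slitPlane hz)
  have hs : (√N : ℝ) ≠ 0 := (Real.sqrt_pos.2 hNpos).ne'
  have hs2 : (√N : ℝ) ^ 2 = N := Real.sq_sqrt hNpos.le
  have hsum : ((((√N * ξ + m / √N : ℝ) : ℂ) + ((√N * ξ + k / √N : ℝ) : ℂ)) ^ 2 / 4 : ℂ) =
      N * ξ ^ 2 + ξ * (m + k) + (m + k) ^ 2 / (4 * N) := by
    have : ((√N * ξ + m / √N) + (√N * ξ + k / √N)) ^ 2 / 4 =
        N * ξ ^ 2 + ξ * (m + k) + (m + k) ^ 2 / (4 * N) := by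
      generalize √(N : ℝ) = q at hs hs2 ⊢
      rw [← hs2]
      field_simp
      ring
    exact_mod_cast congrArg (fun r : ℝ => (r : ℂ)) this
  have hdiff : ((((√N * ξ + m / √N : ℝ) : ℂ) - ((√N * ξ + k / √N : ℝ) : ℂ)) ^ 2 / 4 : ℂ) =
      (m - k) ^ 2 / (4 * N) := by
    have : ((√N * ξ + m / √N) - (√N * ξ + k / √N)) ^ 2 / 4 = (m - k) ^ 2 / (4 * N) := by
      generalize √(N : ℝ) = q at hs hs2 ⊢
      rw [← hs2]
      field_simp
      ring
    exact_mod_cast congrArg (fun r : ℝ => (r : ℂ)) this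
  rw [hsum, hdiff]
  have hpow : ((N * (1 - contourPoint N t ^ 2)) ^ (-(1 / 2) : ℂ) : ℂ) =
      ((N : ℝ) ^ (-(1 / 2) : ℝ) : ℝ) * (1 - contourPoint N t ^ 2) ^ (-(1 / 2) : ℂ) := by
    have := ofReal_mul_cpow hNpos h2 (-(1 / 2))
    rw [ofReal_natCast] at this
    rw [this, ofReal_cpow hNpos.le]
    push_cast
    rfl
  have hN32 : ((N : ℝ) ^ (-(3 / 2) : ℝ)) = (N : ℝ)⁻¹ * (N : ℝ) ^ (-(1 / 2) : ℝ) := by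
    rw [← Real.rpow_neg_one, ← Real.rpow_add hNpos]
    norm_num
  have hexp (A B : ℂ) : exp (1 - t * I + A - N * ξ ^ 2 / 2 - B) =
      (Real.exp (-(N * ξ ^ 2 / 2)) : ℂ) * (exp (1 - t * I) * exp (A - B)) := by
    rw [ofReal_exp, ← Complex.exp_add, ← Complex.exp_add]
    congr 1
    push_cast
    ring
  rw [hpow, hN32, hexp]
  push_cast
  field_simp

lemma tendsto_mul_one_sub_contourPoint (t : ℝ) :
    Tendsto (fun N : ℕ => (N : ℂ) * (1 - contourPoint N t)) atTop (𝓝 (1 - t * I)) := by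
  have hd : HasDerivAt (fun u : ℝ => 1 - exp (-(1 - t * I) * u)) (1 - t * I) 0 := by
    have h1 : HasDerivAt (fun u : ℝ => -(1 - t * I) * (u : ℂ)) (-(1 - t * I) * 1) 0 :=
      (ofRealCLM.hasDerivAt (x := (0 : ℝ))).const_mul _
    have h2 := (h1.cexp).const_sub 1
    simpa using h2
  have h := hd.tendsto_slope_zero_right.comp (g := fun u : ℝ => _) (f := fun N : ℕ => ((N : ℝ))⁻¹)
    (tendsto_inv_atTop_nhdsGT_zero.comp tendsto_natCast_atTop_atTop)
  refine h.congr fun N => ?_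
  simp [contourPoint, div_eq_mul_inv]

lemma tendsto_contourPoint (t : ℝ) :
    Tendsto (fun N : ℕ => contourPoint N t) atTop (𝓝 1) := by
  have h : Tendsto (fun N : ℕ => -(1 - t * I) / (N : ℂ)) atTop (𝓝 0) := by
    simpa [div_eq_mul_inv] using
      (tendsto_inv_atTop_nhds_zero_nat (𝕜 := ℂ)).const_mul (-(1 - t * I))
  have h' := h.cexp
  rwa [Complex.exp_zero] at h'

lemma one_sub_mul_I_mem_slitPlane (t : ℝ) : 1 - t * I ∈ slitPlane := by
  left
  simp

/-- The pointwise limit of the rescaled contour integrand. -/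
noncomputable def limitIntegrand (β ξ m k t : ℝ) : ℂ :=
  exp β * ((1 - t * I) ^ 2)⁻¹ * (2 * (1 - t * I)) ^ (-(1 / 2) : ℂ) *
    exp ((1 - ξ ^ 2 / 4) * (1 - t * I) + ξ * (m + k) / 2 - (m - k) ^ 2 / 4 / (1 - t * I))

lemma tendsto_scaledIntegrand (β ξ m k t : ℝ) :
    Tendsto (fun N => scaledIntegrand β ξ m k N t) atTop (𝓝 (limitIntegrand β ξ m k t)) := by
  have hx := tendsto_contourPoint t
  have hz := tendsto_mul_one_sub_contourPoint t
  have hs := one_sub_mul_I_mem_slitPlane t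
  have hz0 : 1 - t * I ≠ 0 := slitPlane_ne_zero hs
  have hx1 : Tendsto (fun N => 1 + contourPoint N t) atTop (𝓝 2) := by
    simpa [one_add_one_eq_two] using hx.const_add 1
  have hinv : Tendsto (fun N : ℕ => ((N : ℂ))⁻¹) atTop (𝓝 0) := tendsto_inv_atTop_nhds_zero_nat
  have h1 : Tendsto (fun N => exp (β * contourPoint N t ^ 2)) atTop (𝓝 (exp β)) := by
    have := ((hx.pow 2).const_mul (β : ℂ)).cexp
    simpa using this
  have h2 := (hz.pow 2).inv₀ (pow_ne_zero 2 hz0)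
  have h3 : Tendsto (fun N : ℕ => (N * (1 - contourPoint N t ^ 2)) ^ (-(1 / 2) : ℂ)) atTop
      (𝓝 ((2 * (1 - t * I)) ^ (-(1 / 2) : ℂ))) := by
    have h : Tendsto (fun N : ℕ => (N : ℂ) * (1 - contourPoint N t ^ 2)) atTop
        (𝓝 (2 * (1 - t * I))) := by
      rw [mul_comm (2 : ℂ)]
      refine (hz.mul hx1).congr fun N => by ring
    have hs2 : 2 * (1 - t * I) ∈ slitPlane := by
      left
      simp
    exact h.cpow tendsto_const_nhds hs2
  have h4 : Tendsto (fun N : ℕ => exp (1 - t * I +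
      (N * ξ ^ 2 + ξ * (m + k) + (m + k) ^ 2 / (4 * N)) *
      (contourPoint N t / (1 + contourPoint N t)) - N * ξ ^ 2 / 2 -
      (m - k) ^ 2 / (4 * N) * (contourPoint N t / (1 - contourPoint N t)))) atTop
      (𝓝 (exp ((1 - ξ ^ 2 / 4) * (1 - t * I) + ξ * (m + k) / 2 -
        (m - k) ^ 2 / 4 / (1 - t * I)))) := by
    refine Tendsto.cexp ?_
    -- The divergent terms cancel through `N (z / (1 + z) - 1/2) = -N (1 - z) / (2 (1 + z))`.
    have hA := ((hz.div hx1 two_ne_zero).const_mul (-(ξ : ℂ) ^ 2 / 2)).const_add (1 - t * I)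
    have hB := ((hinv.const_mul ((m + k : ℂ) ^ 2 / 4)).const_add ((ξ : ℂ) * (m + k))).mul
      (hx.div hx1 two_ne_zero)
    have hC := (hx.div hz hz0).const_mul ((m - k : ℂ) ^ 2 / 4)
    have hABC := (hA.add hB).sub hC
    have hlim : (1 - t * I + -(ξ : ℂ) ^ 2 / 2 * ((1 - t * I) / 2) +
        (ξ * (m + k) + (m + k : ℂ) ^ 2 / 4 * 0) * (1 / 2) - (m - k : ℂ) ^ 2 / 4 * (1 / (1 - t * I))) =
        (1 - ξ ^ 2 / 4) * (1 - t * I) + ξ * (m + k) / 2 - (m - k) ^ 2 / 4 / (1 - t * I) := by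
      ring
    rw [hlim] at hABC
    refine hABC.congr' ?_
    filter_upwards [eventually_ne_atTop 0] with N hN
    have hNc : (N : ℂ) ≠ 0 := by exact_mod_cast hN
    have hn := norm_contourPoint_lt_one hN t
    have e1 := one_sub_ne_zero_of_norm_lt_one hn
    have e2 : 1 + contourPoint N t ≠ 0 := by
      have := one_sub_ne_zero_of_norm_lt_one (z := -contourPoint N t) (by simpa using hn)
      simpa using this
    simp only [Pi.div_apply]
    field_simp
    ring
  exact ((h1.mul h2).mul h3).mul h4

/-- The Möbius map `z / (1 + z)` sends the unit disc to the half-plane `Re < 1/2`. The bound `1/2`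
is what cancels `N ξ² / 2` in the exponent. -/
lemma re_div_one_add_le {z : ℂ} (hz : ‖z‖ < 1) : (z / (1 + z)).re ≤ 1 / 2 := by
  have h0 : 1 + z ≠ 0 := by
    have := one_sub_ne_zero_of_norm_lt_one (z := -z) (by simpa using hz)
    simpa using this
  have hpos : 0 < normSq (1 + z) := normSq_pos.2 h0
  have hz2 : normSq z < 1 := by
    rw [normSq_eq_norm_sq]
    nlinarith [norm_nonneg z]
  rw [div_re, ← add_div, div_le_iff₀ hpos]
  simp only [normSq_apply, add_re, one_re, add_im, one_im] at hz2 ⊢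
  nlinarith

lemma neg_half_le_re_div_one_sub {z : ℂ} (hz : ‖z‖ < 1) : -(1 / 2) ≤ (z / (1 - z)).re := by
  have h := re_div_one_add_le (z := -z) (by simpa using hz)
  rw [neg_div, neg_re, ← sub_eq_add_neg] at h
  linarith

lemma norm_exp_scaledIntegrand_exponent_le (ξ m k : ℝ) {N : ℕ} (hN : N ≠ 0) (t : ℝ) :
    ‖exp (1 - t * I + (N * ξ ^ 2 + ξ * (m + k) + (m + k) ^ 2 / (4 * N)) *
      (contourPoint N t / (1 + contourPoint N t)) - N * ξ ^ 2 / 2 -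
      (m - k) ^ 2 / (4 * N) * (contourPoint N t / (1 - contourPoint N t)))‖ ≤
    Real.exp (1 + ξ * (m + k) / 2 + (m + k) ^ 2 / 8 + (m - k) ^ 2 / 8) := by
  have hz := norm_contourPoint_lt_one hN t
  have hN1 : (1 : ℝ) ≤ N := by exact_mod_cast Nat.one_le_iff_ne_zero.2 hN
  have hN0 : (0 : ℝ) < N := by linarith
  rw [norm_exp, Real.exp_le_exp]
  have hS : (N * ξ ^ 2 + ξ * (m + k) + (m + k) ^ 2 / (4 * N) : ℂ) =
      ((N * ξ ^ 2 + ξ * (m + k) + (m + k) ^ 2 / (4 * N) : ℝ) : ℂ) := by push_cast; rfl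
  have hD : ((m - k) ^ 2 / (4 * N) : ℂ) = (((m - k) ^ 2 / (4 * N) : ℝ) : ℂ) := by push_cast; rfl
  have hX : (N * ξ ^ 2 / 2 : ℂ) = ((N * ξ ^ 2 / 2 : ℝ) : ℂ) := by push_cast; rfl
  have hre : (1 - t * I : ℂ).re = 1 := by simp
  rw [hS, hD, hX, sub_re, sub_re, add_re, re_ofReal_mul, re_ofReal_mul, ofReal_re, hre]
  -- The coefficient is a perfect square, so the half-plane bound may be multiplied by it.
  have hSnn : 0 ≤ N * ξ ^ 2 + ξ * (m + k) + (m + k) ^ 2 / (4 * N) := by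
    have : N * ξ ^ 2 + ξ * (m + k) + (m + k) ^ 2 / (4 * N) = (2 * N * ξ + (m + k)) ^ 2 / (4 * N) := by
      field_simp
      ring
    rw [this]
    positivity
  have hDnn : 0 ≤ (m - k) ^ 2 / (4 * N) := by positivity
  have h1 := mul_le_mul_of_nonneg_left (re_div_one_add_le hz) hSnn
  have h2 := mul_le_mul_of_nonneg_left (neg_half_le_re_div_one_sub hz) hDnn
  have h3 : (m + k) ^ 2 / (4 * N) ≤ (m + k) ^ 2 / 4 := by
    gcongr
    linarith
  have h4 : (m - k) ^ 2 / (4 * N) ≤ (m - k) ^ 2 / 4 := by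
    gcongr
    linarith
  linarith

lemma exp_neg_one_le_mul_one_sub_exp {N : ℕ} (hN : N ≠ 0) :
    Real.exp (-1) ≤ N * (1 - Real.exp (-(1 / N))) := by
  have hN1 : (1 : ℝ) ≤ N := by exact_mod_cast Nat.one_le_iff_ne_zero.2 hN
  have hN0 : (0 : ℝ) < N := by linarith
  have h1 : 1 / (N : ℝ) + 1 ≤ Real.exp (1 / N) := Real.add_one_le_exp _
  have h2 : Real.exp (-1) ≤ Real.exp (-(1 / N)) := by
    rw [Real.exp_le_exp, neg_le_neg_iff, div_le_one hN0]
    exact hN1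
  have h3 : Real.exp (-(1 / (N : ℝ))) * Real.exp (1 / N) = 1 := by
    rw [← Real.exp_add]
    simp
  have h4 : Real.exp (-(1 / (N : ℝ))) * (1 / N) ≤ 1 - Real.exp (-(1 / N)) := by
    nlinarith [Real.exp_pos (-(1 / (N : ℝ)))]
  calc Real.exp (-1) ≤ N * (Real.exp (-(1 / (N : ℝ))) * (1 / N)) := by field_simp; exact h2
    _ ≤ _ := by gcongr

/-- With `r = exp (-1 / N)` and `θ = t / N`, `|1 - z|² = (1 - r)² + 2 r (1 - cos θ)`. The first term
gives the constant, and `1 - cos θ ≥ 2 θ² / π²` on `[-π, π]` gives the growth in `t`. -/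
lemma le_sq_norm_mul_one_sub_contourPoint {N : ℕ} (hN : N ≠ 0) {t : ℝ} (ht : |t| ≤ Real.pi * N) :
    Real.exp (-2) / 4 * (1 + t ^ 2) ≤ ‖(N : ℂ) * (1 - contourPoint N t)‖ ^ 2 := by
  have hN1 : (1 : ℝ) ≤ N := by exact_mod_cast Nat.one_le_iff_ne_zero.2 hN
  have hN0 : (0 : ℝ) < N := by linarith
  set r := Real.exp (-(1 / N)) with hr
  have hr0 : 0 < r := Real.exp_pos _
  have hr1 : Real.exp (-1) ≤ r := by
    rw [hr, Real.exp_le_exp, neg_le_neg_iff, div_le_one hN0]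
    exact hN1
  have hpt : contourPoint N t = r * (Real.cos (t / N) + Real.sin (t / N) * I) := by
    rw [contourPoint, hr, ofReal_exp, ofReal_cos, ofReal_sin, ← exp_mul_I, ← Complex.exp_add]
    congr 1
    push_cast
    ring
  have hn : ‖1 - contourPoint N t‖ ^ 2 = (1 - r) ^ 2 + 2 * r * (1 - Real.cos (t / N)) := by
    rw [hpt]
    generalize t / (N : ℝ) = θ
    rw [← normSq_eq_norm_sq, normSq_apply]
    simp only [sub_re, sub_im, mul_re, mul_im, add_re, add_im, ofReal_re, ofReal_im, I_re, I_im,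
      one_re, one_im]
    linear_combination r ^ 2 * Real.sin_sq_add_cos_sq θ
  have hcos : Real.cos (t / N) ≤ 1 - 2 / Real.pi ^ 2 * (t / N) ^ 2 := by
    apply Real.cos_le_one_sub_mul_cos_sq
    rw [abs_div, abs_of_pos hN0, div_le_iff₀ hN0]
    exact ht
  -- The constant comes from `π ≤ 4`.
  have hpi : (1 : ℝ) / 8 ≤ 2 / Real.pi ^ 2 := by
    rw [div_le_div_iff₀ (by norm_num) (by positivity)]
    nlinarith [Real.pi_le_four, Real.pi_pos]
  have h1 := exp_neg_one_le_mul_one_sub_exp hN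
  have h2 : Real.exp (-2) ≤ (N * (1 - r)) ^ 2 := by
    rw [show (-2 : ℝ) = -1 + -1 by norm_num, Real.exp_add, ← sq]
    gcongr
  have h3 : Real.exp (-2) ≤ Real.exp (-1) := by
    rw [Real.exp_le_exp]
    norm_num
  have h4 : (1 : ℝ) / 8 * (t / N) ^ 2 ≤ 1 - Real.cos (t / N) := by
    have := mul_le_mul_of_nonneg_right hpi (sq_nonneg (t / N))
    linarith
  have h5 : (N : ℝ) ^ 2 * (t / N) ^ 2 = t ^ 2 := by
    field_simp
  rw [norm_mul, Complex.norm_natCast, mul_pow, hn]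
  have h6 : (N : ℝ) ^ 2 * (2 * r * (1 / 8 * (t / N) ^ 2)) ≤
      (N : ℝ) ^ 2 * (2 * r * (1 - Real.cos (t / N))) := by
    gcongr
  have h7 : (N : ℝ) ^ 2 * (2 * r * (1 / 8 * (t / N) ^ 2)) = r / 4 * t ^ 2 := by
    rw [← h5]
    ring
  have h8 : Real.exp (-2) / 4 * t ^ 2 ≤ r / 4 * t ^ 2 := by
    gcongr
    linarith
  have h9 := Real.exp_pos (-2)
  nlinarith

lemma norm_scaledIntegrand_le (β ξ m k : ℝ) {N : ℕ} (hN : N ≠ 0) {t : ℝ}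
    (ht : |t| ≤ Real.pi * N) :
    ‖scaledIntegrand β ξ m k N t‖ ≤
      (Real.exp |β| * (4 * Real.exp 2) * Real.exp (1 / 2) *
        Real.exp (1 + ξ * (m + k) / 2 + (m + k) ^ 2 / 8 + (m - k) ^ 2 / 8)) * (1 + t ^ 2)⁻¹ := by
  have hz := norm_contourPoint_lt_one hN t
  have h1 : ‖exp (β * contourPoint N t ^ 2)‖ ≤ Real.exp |β| := by
    rw [norm_exp, Real.exp_le_exp]
    refine (re_le_norm _).trans ?_
    rw [norm_mul, norm_pow, norm_real, Real.norm_eq_abs]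
    exact mul_le_of_le_one_right (abs_nonneg β) (pow_le_one₀ (norm_nonneg _) hz.le)
  have h2 : ‖((N * (1 - contourPoint N t)) ^ 2)⁻¹‖ ≤ 4 * Real.exp 2 * (1 + t ^ 2)⁻¹ := by
    rw [norm_inv, norm_pow]
    refine (inv_anti₀ (by positivity) (le_sq_norm_mul_one_sub_contourPoint hN ht)).trans_eq ?_
    rw [mul_inv, inv_div, Real.exp_neg, div_inv_eq_mul]
  -- Only boundedness is available, because `1 - z²` is also small near `z = -1`; all decay in `t`
  -- comes from `h2`.
  have h3 : ‖((N * (1 - contourPoint N t ^ 2)) ^ (-(1 / 2) : ℂ) : ℂ)‖ ≤ Real.exp (1 / 2) := by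
    rw [show (-(1 / 2) : ℂ) = ((-(1 / 2) : ℝ) : ℂ) by push_cast; rfl, norm_cpow_real]
    have hlow : Real.exp (-1) ≤ ‖(N * (1 - contourPoint N t ^ 2) : ℂ)‖ := by
      refine (exp_neg_one_le_mul_one_sub_exp hN).trans ?_
      rw [norm_mul, Complex.norm_natCast]
      gcongr
      have := norm_sub_norm_le (1 : ℂ) (contourPoint N t ^ 2)
      rw [norm_one, norm_pow] at this
      rw [← norm_contourPoint N t]
      nlinarith [norm_nonneg (contourPoint N t)]
    refine (Real.rpow_le_rpow_of_nonpos (Real.exp_pos _) hlow (by norm_num)).trans_eq ?_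
    rw [← Real.exp_mul]
    norm_num
  have h4 := norm_exp_scaledIntegrand_exponent_le ξ m k hN t
  rw [scaledIntegrand, norm_mul, norm_mul, norm_mul]
  calc _ ≤ Real.exp |β| * (4 * Real.exp 2 * (1 + t ^ 2)⁻¹) * Real.exp (1 / 2) *
        Real.exp (1 + ξ * (m + k) / 2 + (m + k) ^ 2 / 8 + (m - k) ^ 2 / 8) := by gcongr
    _ = _ := by ring

lemma measurable_scaledIntegrand (β ξ m k : ℝ) (N : ℕ) : Measurable (scaledIntegrand β ξ m k N) := by
  have : Measurable (contourPoint N) := by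
    unfold contourPoint
    fun_prop
  unfold scaledIntegrand
  fun_prop

lemma tendsto_integral_scaledIntegrand (β ξ m k : ℝ) :
    Tendsto (fun N : ℕ => ∫ t in -(Real.pi * N)..Real.pi * N, scaledIntegrand β ξ m k N t) atTop
      (𝓝 (∫ t, limitIntegrand β ξ m k t)) := by
  have heq (N : ℕ) : ∫ t in -(Real.pi * N)..Real.pi * N, scaledIntegrand β ξ m k N t =
      ∫ t, (Set.Ioc (-(Real.pi * N)) (Real.pi * N)).indicator (scaledIntegrand β ξ m k N) t := by
    have : 0 ≤ Real.pi * N := by positivity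
    rw [intervalIntegral.integral_of_le (by linarith), integral_indicator measurableSet_Ioc]
  simp only [heq]
  refine tendsto_integral_of_dominated_convergence (fun t => (Real.exp |β| * (4 * Real.exp 2) *
    Real.exp (1 / 2) * Real.exp (1 + ξ * (m + k) / 2 + (m + k) ^ 2 / 8 + (m - k) ^ 2 / 8)) *
      (1 + t ^ 2)⁻¹) (fun N => ?_) (integrable_inv_one_add_sq.const_mul _) (fun N => ?_) ?_
  · exact ((measurable_scaledIntegrand β ξ m k N).indicator measurableSet_Ioc).aestronglyMeasurable
  · refine ae_of_all _ fun t => ?_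
    by_cases ht : t ∈ Set.Ioc (-(Real.pi * N)) (Real.pi * N)
    · rw [Set.indicator_of_mem ht]
      rcases eq_or_ne N 0 with rfl | hN
      · simp only [Nat.cast_zero, mul_zero, neg_zero, Set.Ioc_self, Set.mem_empty_iff_false] at ht
      · exact norm_scaledIntegrand_le β ξ m k hN (abs_le.2 ⟨ht.1.le, ht.2⟩)
    · rw [Set.indicator_of_notMem ht, norm_zero]
      positivity
  · refine ae_of_all _ fun t => (tendsto_scaledIntegrand β ξ m k t).congr' ?_
    have hN : Tendsto (fun N : ℕ => Real.pi * (N : ℝ)) atTop atTop :=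
      tendsto_natCast_atTop_atTop.const_mul_atTop Real.pi_pos
    filter_upwards [hN.eventually_gt_atTop |t|] with N hN
    rw [Set.indicator_of_mem]
    exact ⟨(abs_lt.1 hN).1, (abs_lt.1 hN).2.le⟩

end Asymptotics

/-! ### The inverse Laplace transform of a power. -/

section
open Complex

lemma integrableOn_rpow_mul_exp_neg {s r : ℝ} (hs : 0 < s) (hr : 0 < r) :
    IntegrableOn (fun u : ℝ => u ^ (s - 1) * Real.exp (-(r * u))) (Set.Ioi 0) := by
  have h := integrableOn_rpow_mul_exp_neg_mul_rpow (s := s - 1) (p := 1) (b := r)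
    (by linarith) one_pos hr
  simpa [neg_mul] using h

/-- The Gamma integral with a complex rate. -/
lemma integral_rpow_mul_cexp_neg_mul {s : ℝ} (hs : 0 < s) {z : ℂ} (hz : 0 < z.re) :
    ∫ u in Set.Ioi (0 : ℝ), ((u ^ (s - 1) : ℝ) : ℂ) * exp (-(z * u)) =
      Real.Gamma s * z ^ (-s : ℂ) := by
  -- The integral is the complex moment generating function of `ν` at `-z`, hence analytic for `Re z
  -- > 0`; the identity theorem extends the formula from positive reals.
  set ν : Measure ℝ := (volume.restrict (Set.Ioi 0)).withDensity
    fun u => ((Real.toNNReal (u ^ (s - 1)) : NNReal) : ENNReal) with hν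
  have hmeas : Measurable fun u : ℝ => Real.toNNReal (u ^ (s - 1)) := by fun_prop
  have hmgf (w : ℂ) : complexMGF id ν (-w) =
      ∫ u in Set.Ioi (0 : ℝ), ((u ^ (s - 1) : ℝ) : ℂ) * exp (-(w * u)) := by
    rw [complexMGF, hν, integral_withDensity_eq_integral_smul hmeas]
    refine setIntegral_congr_fun measurableSet_Ioi fun u hu => ?_
    have hu : 0 ≤ u ^ (s - 1) := Real.rpow_nonneg (Set.mem_Ioi.1 hu).le _
    simp [NNReal.smul_def, hu]
  have hset : Set.Iio 0 ⊆ integrableExpSet id ν := fun t ht => by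
    rw [integrableExpSet, Set.mem_ofPred_eq, hν, integrable_withDensity_iff_integrable_smul hmeas]
    refine (integrableOn_rpow_mul_exp_neg hs (neg_pos.2 ht)).congr_fun (fun u hu => ?_)
      measurableSet_Ioi
    have hu : 0 ≤ u ^ (s - 1) := Real.rpow_nonneg (Set.mem_Ioi.1 hu).le _
    simp [NNReal.smul_def, hu]
  have hint : Set.Iio 0 ⊆ interior (integrableExpSet id ν) := isOpen_Iio.subset_interior_iff.2 hset
  have hopen : IsOpen {w : ℂ | 0 < w.re} := isOpen_lt continuous_const continuous_re
  have hF : AnalyticOnNhd ℂ (fun w => complexMGF id ν (-w)) {w : ℂ | 0 < w.re} := fun w hw =>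
    (analyticAt_complexMGF (z := -w) (hint (by simpa using hw))).comp analyticAt_id.neg
  have hG : AnalyticOnNhd ℂ (fun w : ℂ => (Real.Gamma s : ℂ) * w ^ (-s : ℂ)) {w : ℂ | 0 < w.re} :=
    fun w hw => analyticAt_const.mul (analyticAt_id.cpow analyticAt_const (Or.inl hw))
  have hreal (r : ℝ) (hr : 0 < r) :
      complexMGF id ν (-(r : ℂ)) = (Real.Gamma s : ℂ) * (r : ℂ) ^ (-s : ℂ) := by
    rw [hmgf, ← ofReal_neg, ← ofReal_cpow hr.le, ← ofReal_mul]
    simp_rw [← ofReal_mul, ← ofReal_neg, ← ofReal_exp, ← ofReal_mul]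
    rw [integral_complex_ofReal, Real.integral_rpow_mul_exp_neg_mul_Ioi hs hr, one_div,
      Real.inv_rpow hr.le, ← Real.rpow_neg hr.le, mul_comm]
  have hconv : IsPreconnected {w : ℂ | 0 < w.re} := (convex_halfSpace_re_gt 0).isPreconnected
  have hmap : Tendsto (fun r : ℝ => (r : ℂ)) (𝓝[≠] 1) (𝓝[≠] 1) := by
    refine tendsto_nhdsWithin_iff.2 ⟨?_, ?_⟩
    · exact (continuous_ofReal.tendsto' (1 : ℝ) 1 ofReal_one).mono_left nhdsWithin_le_nhds
    · filter_upwards [self_mem_nhdsWithin] with r hr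
      simpa using hr
  have hfreq : ∃ᶠ w in 𝓝[≠] (1 : ℂ), complexMGF id ν (-w) = (Real.Gamma s : ℂ) * w ^ (-s : ℂ) := by
    refine hmap.frequently (Eventually.frequently ?_)
    filter_upwards [nhdsWithin_le_nhds (lt_mem_nhds (zero_lt_one (α := ℝ)))] with r hr
    exact hreal r hr
  rw [← hmgf]
  exact hF.eqOn_of_preconnected_of_frequently_eq hG hconv (by simp) hfreq hz

lemma norm_one_sub_mul_I_cpow_le {s : ℝ} (hs : 2 ≤ s) (t : ℝ) :
    ‖(1 - t * I) ^ (-s : ℂ)‖ ≤ (1 + t ^ 2)⁻¹ := by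
  have h0 : (1 - t * I) ≠ 0 := slitPlane_ne_zero (one_sub_mul_I_mem_slitPlane t)
  have hsq : ‖(1 - t * I)‖ ^ 2 = 1 + t ^ 2 := by
    rw [← normSq_eq_norm_sq, normSq_apply]
    simp
    ring
  have h1 : 1 ≤ ‖(1 - t * I)‖ := by
    rw [← one_le_sq_iff₀ (norm_nonneg _), hsq]
    nlinarith [sq_nonneg t]
  rw [← ofReal_neg, norm_cpow_real, ← hsq, ← Real.rpow_natCast, ← Real.rpow_neg (norm_nonneg _)]
  exact Real.rpow_le_rpow_of_exponent_le h1 (by push_cast; linarith)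

lemma continuous_one_sub_mul_I_cpow (s : ℂ) : Continuous fun t : ℝ => (1 - t * I) ^ s :=
  Continuous.cpow (by fun_prop) continuous_const fun t => one_sub_mul_I_mem_slitPlane t

lemma integrable_one_sub_mul_I_cpow {s : ℝ} (hs : 2 ≤ s) :
    Integrable fun t : ℝ => (1 - t * I) ^ (-s : ℂ) :=
  integrable_inv_one_add_sq.mono' (continuous_one_sub_mul_I_cpow _).aestronglyMeasurable
    (ae_of_all _ fun t => norm_one_sub_mul_I_cpow_le hs t)

open FourierTransform in
/-- The inverse Laplace transform of a power. -/
lemma integral_cexp_mul_one_sub_mul_I_cpow {s a : ℝ} (hs : 2 ≤ s) (ha : 0 < a) :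
    ∫ t : ℝ, exp (a * (1 - t * I)) * (1 - t * I) ^ (-s : ℂ) =
      ((2 * Real.pi * a ^ (s - 1) / Real.Gamma s : ℝ) : ℂ) := by
  have hs0 : 0 < s := by linarith
  -- The Gamma integral computes the Fourier transform of `f`, and Fourier inversion at `a` gives
  -- the claim. Since `s ≥ 2`, `f` is continuous and its transform is integrable.
  set f : ℝ → ℂ := fun u => (((max u 0) ^ (s - 1) * Real.exp (-u) : ℝ) : ℂ) with hf
  have hsupp : (Set.Ioi 0).indicator f = f := by
    ext u
    by_cases hu : u ∈ Set.Ioi (0 : ℝ)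
    · rw [Set.indicator_of_mem hu]
    · rw [Set.indicator_of_notMem hu, hf]
      have : max u 0 = 0 := max_eq_right (not_lt.1 hu)
      simp [this, Real.zero_rpow (by linarith : s - 1 ≠ 0)]
  have hcont : Continuous f := by
    refine continuous_ofReal.comp (Continuous.mul ?_ (by fun_prop))
    exact (continuous_id.max continuous_const).rpow_const fun _ => Or.inr (by linarith)
  have hfint : Integrable f := by
    rw [← hsupp, integrable_indicator_iff measurableSet_Ioi]
    refine (IntegrableOn.congr_fun (integrableOn_rpow_mul_exp_neg hs0 one_pos).ofReal
      (fun u hu => ?_) measurableSet_Ioi)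
    simp [hf, max_eq_left (Set.mem_Ioi.1 hu).le]
  have hfourier (w : ℝ) : 𝓕 f w = Real.Gamma s * (1 - (-(2 * Real.pi) * w : ℝ) * I) ^ (-s : ℂ) := by
    rw [Real.fourier_real_eq_integral_exp_smul, ← integral_rpow_mul_cexp_neg_mul hs0 (by simp),
      ← integral_indicator measurableSet_Ioi]
    refine integral_congr_ae (ae_of_all _ fun u => ?_)
    by_cases hu : u ∈ Set.Ioi (0 : ℝ)
    · simp only [Set.indicator_of_mem hu, hf, max_eq_left (Set.mem_Ioi.1 hu).le, smul_eq_mul]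
      push_cast
      rw [mul_left_comm, ← exp_add]
      congr 2
      ring
    · simp only [Set.indicator_of_notMem hu]
      rw [← hsupp, Set.indicator_of_notMem hu, smul_zero]
  have hpi : -(2 * Real.pi) ≠ 0 := by simp [Real.pi_ne_zero]
  have hFint : Integrable (𝓕 f) := by
    have h := ((integrable_one_sub_mul_I_cpow hs).comp_mul_left' hpi).const_mul (Real.Gamma s : ℂ)
    refine h.congr (ae_of_all _ fun w => ?_)
    rw [hfourier]
  have hinv := congrFun (hcont.fourierInv_fourier_eq hfint hFint) a
  rw [Real.fourierInv_eq'] at hinv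
  simp_rw [hfourier] at hinv
  have hsub := Measure.integral_comp_mul_left
    (fun t : ℝ => exp (a * (1 - t * I)) * (1 - t * I) ^ (-s : ℂ)) (-(2 * Real.pi))
  have hG : Real.Gamma s ≠ 0 := (Real.Gamma_pos_of_pos hs0).ne'
  have hlhs : (∫ w : ℝ, exp (a * (1 - (-(2 * Real.pi) * w : ℝ) * I)) *
      (1 - (-(2 * Real.pi) * w : ℝ) * I) ^ (-s : ℂ)) = exp a * (Real.Gamma s : ℂ)⁻¹ * f a := by
    rw [← hinv, ← integral_const_mul]
    refine integral_congr_ae (ae_of_all _ fun w => ?_)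
    have hGc : (Real.Gamma s : ℂ) ≠ 0 := ofReal_ne_zero.2 hG
    simp only [smul_eq_mul, RCLike.inner_apply, conj_trivial]
    rw [mul_sub, mul_one, sub_eq_add_neg, exp_add]
    rw [show exp ((2 * Real.pi * (a * w) : ℝ) * I) = exp (-(a * ((-(2 * Real.pi) * w : ℝ) * I))) by
      push_cast; congr 1; ring]
    field_simp
  rw [hlhs] at hsub
  have habs : |(-(2 * Real.pi))⁻¹| = (2 * Real.pi)⁻¹ := by
    rw [inv_neg, abs_neg, abs_of_pos (by positivity)]
  rw [habs, real_smul] at hsub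
  have h2 : ((2 * Real.pi : ℝ) : ℂ) ≠ 0 := ofReal_ne_zero.2 (by positivity)
  rw [ofReal_inv, eq_inv_mul_iff_mul_eq₀ h2] at hsub
  rw [← hsub, hf]
  simp only [max_eq_left ha.le]
  rw [← ofReal_exp, ← ofReal_inv, ← ofReal_mul, ← ofReal_mul, ← ofReal_mul, Real.exp_neg]
  congr 1
  field_simp

end

/-! ### Evaluation of the limiting integral. -/

section
open Complex

/-- Expansion of `exp (-c / (1 - i t))` in powers of `c`, integrated termwise with exponent `s = n +
5/2`; `|1 - i t| ≥ 1` makes the domination summable. -/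
lemma hasSum_integral_cexp_mul_one_sub_mul_I_cpow {a : ℝ} (ha : 0 < a) (c : ℝ) :
    HasSum (fun n : ℕ => (((-c) ^ n / n ! *
        (2 * Real.pi * a ^ ((n : ℝ) + 3 / 2) / Real.Gamma (n + 5 / 2)) : ℝ) : ℂ))
      (∫ t : ℝ, (1 - t * I) ^ (-(5 / 2 : ℝ) : ℂ) * exp (a * (1 - t * I) - c / (1 - t * I))) := by
  set F : ℕ → ℝ → ℂ := fun n t =>
    (((-c) ^ n / n ! : ℝ) : ℂ) * (exp (a * (1 - t * I)) * (1 - t * I) ^ (-((n + 5 / 2 : ℝ) : ℂ)))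
    with hF
  have hs (n : ℕ) : (2 : ℝ) ≤ n + 5 / 2 := by linarith [n.cast_nonneg (α := ℝ)]
  have hterm (n : ℕ) : ∫ t, F n t = (((-c) ^ n / n ! *
        (2 * Real.pi * a ^ ((n : ℝ) + 3 / 2) / Real.Gamma (n + 5 / 2)) : ℝ) : ℂ) := by
    rw [hF, integral_const_mul, integral_cexp_mul_one_sub_mul_I_cpow (hs n) ha, ← ofReal_mul]
    congr 5
    ring
  have hexp : Summable fun n : ℕ => |c| ^ n / n ! := Real.summable_pow_div_factorial |c|
  rw [← funext hterm]
  refine hasSum_integral_of_dominated_convergence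
    (fun n t => |c| ^ n / n ! * (Real.exp a * (1 + t ^ 2)⁻¹)) (fun n => ?_) (fun n => ?_)
    (ae_of_all _ fun t => hexp.mul_right _) ?_ (ae_of_all _ fun t => ?_)
  · have := continuous_one_sub_mul_I_cpow (-((n + 5 / 2 : ℝ) : ℂ))
    exact Continuous.aestronglyMeasurable (by fun_prop)
  · refine ae_of_all _ fun t => ?_
    rw [hF]
    simp only [norm_mul, norm_exp]
    refine mul_le_mul (by simp) (mul_le_mul (by simp) (norm_one_sub_mul_I_cpow_le (hs n) t)
      (norm_nonneg _) (Real.exp_nonneg _)) (by positivity) (by positivity)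
  · simp_rw [tsum_mul_right]
    exact (integrable_inv_one_add_sq.const_mul _).const_mul _
  · have hz : (1 - t * I) ≠ 0 := slitPlane_ne_zero (one_sub_mul_I_mem_slitPlane t)
    have h := ((NormedSpace.expSeries_div_hasSum_exp (-c / (1 - t * I) : ℂ)).mul_left
      ((1 - t * I) ^ (-(5 / 2 : ℝ) : ℂ) * exp (a * (1 - t * I))))
    rw [← exp_eq_exp_ℂ, mul_assoc, ← exp_add, neg_div, ← sub_eq_add_neg] at h
    convert! h using 1
    ext n
    rw [hF]
    simp only
    rw [ofReal_add, neg_add, cpow_add _ _ hz, cpow_neg _ (((n : ℝ) : ℂ)), ofReal_natCast,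
      cpow_natCast, ← neg_div, div_pow]
    push_cast
    field_simp

lemma hasSum_limitT (y : ℝ) :
    HasSum (fun n : ℕ => (-1) ^ n * (8 * (n + 1) * y ^ (2 * n)) / (2 * n + 3)!) (8 * limitT y) := by
  rcases eq_or_ne y 0 with rfl | hy
  · have h := hasSum_single (f := fun n : ℕ =>
      (-1) ^ n * (8 * (n + 1) * (0 : ℝ) ^ (2 * n)) / (2 * n + 3)!) 0 fun n hn => by simp [hn]
    convert h using 1
    norm_num [limitT, Nat.factorial]
  -- The leading terms `y` of the sine and `1` of the cosine are dropped: their contributions `1 /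
  -- y²` cancel.
  · have h1 := (hasSum_nat_add_iff' 1).2 (Real.hasSum_sin y)
    have h2 := (hasSum_nat_add_iff' 1).2 (Real.hasSum_cos y)
    have h := ((h1.mul_right (1 / y ^ 3)).sub (h2.mul_right (1 / y ^ 2))).mul_left 4
    convert! h using 1
    · ext n
      have e1 : 2 * (n + 1) + 1 = 2 * n + 3 := by ring
      have e2 : (2 * n + 3)! = (2 * n + 3) * (2 * (n + 1))! := by
        rw [show 2 * n + 3 = 2 * (n + 1) + 1 by ring, Nat.factorial_succ]
      rw [e1, e2]
      have : ((2 * (n + 1))! : ℝ) ≠ 0 := Nat.cast_ne_zero.2 (Nat.factorial_ne_zero _)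
      have : (2 * n + 3 : ℝ) ≠ 0 := by positivity
      push_cast
      field_simp
      ring
    · rw [limitT, if_neg hy]
      simp
      field_simp
      ring

/-- The half-integer values of Gamma turn the Bessel-type coefficients into those of the elementary
series `hasSum_limitT`. -/
lemma sqrt_pi_div_factorial_mul_Gamma (n : ℕ) :
    √Real.pi / (n ! * Real.Gamma (n + 5 / 2)) = 8 * (n + 1) * 4 ^ n / (2 * n + 3)! := by
  have h := Real.Gamma_nat_add_half (n + 2)
  rw [show ((n + 2 : ℕ) : ℝ) + 1 / 2 = n + 5 / 2 by push_cast; ring,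
    show 2 * (n + 2) - 1 = 2 * n + 3 by omega] at h
  have h2 : (2 * n + 3)! = (2 * n + 3)‼ * (2 ^ (n + 1) * (n + 1)!) := by
    rw [← Nat.doubleFactorial_two_mul, show 2 * n + 3 = 2 * (n + 1) + 1 by ring,
      Nat.factorial_eq_mul_doubleFactorial]
  have h3 : ((2 * n + 3)‼ : ℝ) ≠ 0 := Nat.cast_ne_zero.2 (Nat.doubleFactorial_pos _).ne'
  have h4 : (n ! : ℝ) ≠ 0 := Nat.cast_ne_zero.2 (Nat.factorial_ne_zero _)
  have h5 : (n + 1 : ℝ) ≠ 0 := by positivity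
  have h6 : √Real.pi ≠ 0 := (Real.sqrt_pos.2 Real.pi_pos).ne'
  rw [h, h2, Nat.factorial_succ, show (4 : ℝ) = 2 ^ 2 by norm_num, ← pow_mul]
  push_cast
  field_simp
  ring

lemma sqrt_pi_mul_integral {a : ℝ} (ha : 0 < a) {c y : ℝ} (hy : y ^ 2 = 4 * (a * c)) :
    √Real.pi * ∫ t : ℝ, (1 - t * I) ^ (-(5 / 2 : ℝ) : ℂ) *
        exp (a * (1 - t * I) - c / (1 - t * I)) =
      ((2 * Real.pi * a ^ (3 / 2 : ℝ) * (8 * limitT y) : ℝ) : ℂ) := by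
  have h1 := (hasSum_integral_cexp_mul_one_sub_mul_I_cpow ha c).mul_left (√Real.pi : ℂ)
  have h2 := hasSum_ofReal.2 ((hasSum_limitT y).mul_left (2 * Real.pi * a ^ (3 / 2 : ℝ)))
  refine h1.unique ?_
  convert! h2 using 1
  ext n
  rw [← ofReal_mul]
  congr 1
  have e1 := sqrt_pi_div_factorial_mul_Gamma n
  have hG : Real.Gamma (n + 5 / 2) ≠ 0 := (Real.Gamma_pos_of_pos (by positivity)).ne'
  have h4 : (n ! : ℝ) ≠ 0 := Nat.cast_ne_zero.2 (Nat.factorial_ne_zero _)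
  have e2 : y ^ (2 * n) = 4 ^ n * (a ^ n * c ^ n) := by rw [pow_mul, hy, mul_pow, mul_pow]
  have e3 : a ^ ((n : ℝ) + 3 / 2) = a ^ n * a ^ (3 / 2 : ℝ) := by
    rw [Real.rpow_add ha, Real.rpow_natCast]
  symm
  calc 2 * Real.pi * a ^ (3 / 2 : ℝ) * ((-1) ^ n * (8 * (n + 1) * y ^ (2 * n)) / (2 * n + 3)!)
      = 2 * Real.pi * a ^ (3 / 2 : ℝ) * (-1) ^ n * (a ^ n * c ^ n) *
        (8 * (n + 1) * 4 ^ n / (2 * n + 3)!) := by rw [e2]; ring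
    _ = √Real.pi * ((-c) ^ n / n ! *
        (2 * Real.pi * a ^ ((n : ℝ) + 3 / 2) / Real.Gamma (n + 5 / 2))) := by
      rw [← e1, e3, neg_pow c]
      field_simp

lemma limitIntegrand_eq (β ξ m k t : ℝ) :
    limitIntegrand β ξ m k t = ((Real.exp β * Real.exp (ξ * (m + k) / 2) / √2 : ℝ) : ℂ) *
      ((1 - t * I) ^ (-(5 / 2 : ℝ) : ℂ) *
        exp ((1 - ξ ^ 2 / 4 : ℝ) * (1 - t * I) - ((m - k) ^ 2 / 4 : ℝ) / (1 - t * I))) := by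
  have hz : (1 - t * I) ≠ 0 := slitPlane_ne_zero (one_sub_mul_I_mem_slitPlane t)
  have h1 : (1 - t * I) ^ (-(5 / 2 : ℝ) : ℂ) =
      (1 - t * I) ^ (-(1 / 2) : ℂ) * ((1 - t * I) ^ 2)⁻¹ := by
    rw [show (-(5 / 2 : ℝ) : ℂ) = -(1 / 2) - (2 : ℕ) by push_cast; ring, cpow_sub _ _ hz,
      cpow_natCast, div_eq_mul_inv]
  have h2 : (2 : ℂ) ^ (-(1 / 2) : ℂ) = ((√2 : ℝ) : ℂ)⁻¹ := by
    rw [cpow_neg, Real.sqrt_eq_rpow, ofReal_cpow zero_le_two]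
    norm_num
  have h3 := ofReal_mul_cpow zero_lt_two hz (-(1 / 2))
  rw [ofReal_ofNat] at h3
  rw [limitIntegrand, h3, h1, h2, add_sub_right_comm, exp_add]
  push_cast
  ring

lemma sqrt_mul_integral_limitIntegrand (β : ℝ) {ξ : ℝ} (hξ : 0 < 1 - ξ ^ 2 / 4) (m k : ℝ) {y : ℝ}
    (hy : y ^ 2 = (1 - ξ ^ 2 / 4) * (m - k) ^ 2) :
    √(2 * Real.pi) * ((2 * Real.pi : ℂ)⁻¹ * ∫ t, limitIntegrand β ξ m k t) =
      ((Real.exp β * Real.exp (ξ * (m + k) / 2) * (1 - ξ ^ 2 / 4) ^ (3 / 2 : ℝ) *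
        (8 * limitT y) : ℝ) : ℂ) := by
  have h := sqrt_pi_mul_integral hξ (c := (m - k) ^ 2 / 4) (y := y) (by rw [hy]; ring)
  have h2 : ((√2 : ℝ) : ℂ) ≠ 0 := ofReal_ne_zero.2 (by positivity)
  have hpi : (Real.pi : ℂ) ≠ 0 := ofReal_ne_zero.2 Real.pi_ne_zero
  simp_rw [limitIntegrand_eq]
  rw [integral_const_mul, Real.sqrt_mul zero_le_two]
  set J := ∫ t : ℝ, (1 - t * I) ^ (-(5 / 2 : ℝ) : ℂ) *
    exp ((1 - ξ ^ 2 / 4 : ℝ) * (1 - t * I) - ((m - k) ^ 2 / 4 : ℝ) / (1 - t * I)) with hJ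
  have e : ((√2 * √Real.pi : ℝ) : ℂ) * ((2 * Real.pi : ℂ)⁻¹ *
      (((Real.exp β * Real.exp (ξ * (m + k) / 2) / √2 : ℝ) : ℂ) * J)) =
      (Real.exp β * Real.exp (ξ * (m + k) / 2) : ℝ) * (2 * Real.pi : ℂ)⁻¹ * (√Real.pi * J) := by
    push_cast
    field_simp
  rw [e, h]
  push_cast
  field_simp

end

/-! ### The limit theorem. -/

theorem theorem1p1 {Ω : Type*} [MeasurableSpace Ω] (P : Measure Ω) [IsProbabilityMeasure P]
    (Q : Measure ℝ) [IsProbabilityMeasure Q]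
    (hmean : ∫ x, x ∂Q = 0) (hvar : ∫ x, x ^ 2 ∂Q = 1)
    (hfourth : Integrable (fun x : ℝ => x ^ 4) Q)
    (b : ℝ) (hb : b = ∫ x, x ^ 4 ∂Q)
    (X : ℕ → ℕ → Ω → ℝ) (hX : IsWignerArray P Q X)
    (ξ : ℝ) (hξ : ξ ∈ Set.Ioo (-2 : ℝ) 2) (μ ν : ℝ) :
    (∀ (N : ℕ) (s t : ℝ), Integrable (charDetProd X N s t) P) ∧
    Tendsto
      (fun N : ℕ =>
        √(2 * Real.pi / (N : ℝ) ^ 3) * (1 / (N ! : ℝ)) * Real.exp (-((N : ℝ) * ξ ^ 2 / 2)) *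
          corrFun P X N
            (√(N : ℝ) * ξ + μ / (√(N : ℝ) * semicircleDensity ξ))
            (√(N : ℝ) * ξ + ν / (√(N : ℝ) * semicircleDensity ξ)))
      atTop
      (𝓝 (Real.exp ((b - 3) / 2) * Real.exp (ξ * (μ + ν) / (2 * semicircleDensity ξ)) *
        (2 * Real.pi * semicircleDensity ξ) ^ 3 * limitT (Real.pi * (μ - ν)))) := by
  have hdet (N : ℕ) (s t : ℝ) : HasMean P (charDetProd X N s t)
      ((N ! : ℝ) * weightedSum ((b - 3) / 2) (mehlerTerm s t) N) :=
    hX.hasMean_det_mul_det hmean hvar hfourth hb Fin.val_injective s t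
  refine ⟨fun N s t => (hdet N s t).1, ?_⟩
  have ha : 0 < 1 - ξ ^ 2 / 4 := by nlinarith [hξ.1, hξ.2]
  set ρ := semicircleDensity ξ with hρ
  have hsqrt : 2 * Real.pi * ρ = 2 * √(1 - ξ ^ 2 / 4) := by
    rw [hρ, semicircleDensity, show 4 - ξ ^ 2 = 2 ^ 2 * (1 - ξ ^ 2 / 4) by ring,
      Real.sqrt_mul (by positivity), Real.sqrt_sq zero_le_two]
    field_simp
  have hρ2 : (1 - ξ ^ 2 / 4) = (Real.pi * ρ) ^ 2 := by
    rw [← Real.sq_sqrt ha.le, show √(1 - ξ ^ 2 / 4) = Real.pi * ρ by linarith]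
  have hρ0 : 0 < ρ := by
    have := Real.sqrt_pos.2 ha
    have h : 0 < 2 * Real.pi * ρ := by linarith
    exact pos_of_mul_pos_right h (by positivity)
  have hlim := ((tendsto_integral_scaledIntegrand ((b - 3) / 2) ξ (μ / ρ) (ν / ρ)).const_mul
    ((2 * Real.pi : ℂ)⁻¹)).const_mul (√(2 * Real.pi) : ℂ)
  -- As `1 - ξ² / 4 = (π ρ)²`, the argument `π (μ - ν)` has the required square `(π ρ)² (μ / ρ - ν /
  -- ρ)²`; its sign is irrelevant.
  rw [sqrt_mul_integral_limitIntegrand _ ha (μ / ρ) (ν / ρ) (y := Real.pi * (μ - ν))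
    (by rw [hρ2]; field_simp)] at hlim
  have hre := (Complex.continuous_re.tendsto _).comp hlim
  rw [Complex.ofReal_re] at hre
  have hvalue : Real.exp ((b - 3) / 2) * Real.exp (ξ * (μ / ρ + ν / ρ) / 2) *
      (1 - ξ ^ 2 / 4) ^ (3 / 2 : ℝ) * (8 * limitT (Real.pi * (μ - ν))) =
      Real.exp ((b - 3) / 2) * Real.exp (ξ * (μ + ν) / (2 * ρ)) * (2 * Real.pi * ρ) ^ 3 *
        limitT (Real.pi * (μ - ν)) := by
    have h1 : (1 - ξ ^ 2 / 4) ^ (3 / 2 : ℝ) = (Real.pi * ρ) ^ 3 := by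
      rw [hρ2, ← Real.rpow_natCast (Real.pi * ρ) 2, ← Real.rpow_mul (by positivity),
        ← Real.rpow_natCast]
      norm_num
    rw [h1, show ξ * (μ / ρ + ν / ρ) / 2 = ξ * (μ + ν) / (2 * ρ) by field_simp]
    ring
  rw [hvalue] at hre
  refine hre.congr' ?_
  filter_upwards [eventually_ne_atTop 0] with N hN
  have hN0 : (0 : ℝ) < N := Nat.cast_pos.2 (Nat.pos_of_ne_zero hN)
  have hfac : (N ! : ℝ) ≠ 0 := Nat.cast_ne_zero.2 (Nat.factorial_ne_zero _)
  have hint := weightedSum_mehlerTerm_eq_integral ((b - 3) / 2) (√N * ξ + μ / ρ / √N)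
    (√N * ξ + ν / ρ / √N) hN
  have hpow : √(2 * Real.pi / (N : ℝ) ^ 3) = √(2 * Real.pi) * (N : ℝ) ^ (-(3 / 2) : ℝ) := by
    rw [Real.sqrt_div (by positivity), div_eq_mul_inv, Real.sqrt_eq_rpow ((N : ℝ) ^ 3),
      ← Real.rpow_natCast, ← Real.rpow_mul hN0.le, ← Real.rpow_neg hN0.le]
    norm_num
  have hdiv (x : ℝ) : x / (√N * ρ) = x / ρ / √N := by rw [div_div, mul_comm]
  rw [corrFun, (hdet N _ _).2, hdiv, hdiv, hpow]
  simp_rw [Function.comp_apply, ← scaledIntegrand_eq ((b - 3) / 2) ξ (μ / ρ) (ν / ρ) hN]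
  rw [intervalIntegral.integral_const_mul, mul_left_comm _ _ (intervalIntegral _ _ _ _), ← hint,
    ← Complex.ofReal_mul, ← Complex.ofReal_mul, Complex.ofReal_re]
  field_simp
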